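/- Let $\Theta=\{(y,z)\in\mathbb{R}^2 : y>0,\text{ or } y=0 \text{ and } z>0\}$. For $(y,z)\in\Theta$ and real $R\ge 3$ put $$\varphi(y,z;R)=\exp\bigl((\log R)^{1+y}(\log\log R)^z\bigr),\qquad \xi(y,z;X)=1+\sum_{m=3}^{\infty}X^{\lfloor \varphi(y,z;m)\rfloor}.$$ A Pisot number is a real algebraic integer $\beta>1$ all of whose conjugates over $\mathbb{Q}$ other than $\beta$ itself have absolute value less than $1$. A Salem number is a real algebraic integer $\beta>1$ all of whose conjugates over $\mathbb{Q}$ other than $\beta$ itself have absolute value at most $1$, with at least one conjugate of absolute value exactly $1$. Let $(y_1,z_1)$ and $(y_2,z_2)$ be distinct elements of $\Theta$, and let $\beta$ be a Pisot or Salem number. Then the two real numbers $\xi(y_1,z_1;\beta^{-1})$ and $\xi(y_2,z_2;\beta^{-1})$ are algebraically independent over $\mathbb{Q}$. -/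

import Mathlib

namespace BetaSeries

/-- A Pisot number: a real algebraic integer `β > 1` all of whose conjugates over `ℚ` other than
`β` itself have absolute value less than `1`. -/
def IsPisot (β : ℝ) : Prop :=
  1 < β ∧ IsIntegral ℤ β ∧ ∀ γ : ℂ, IsConjRoot ℚ (β : ℂ) γ → γ ≠ (β : ℂ) → ‖γ‖ < 1

/-- A Salem number: a real algebraic integer `β > 1` all of whose conjugates over `ℚ` other than
`β` itself have absolute value at most `1`, at least one of them having absolute value `1`. -/
def IsSalem (β : ℝ) : Prop :=
  1 < β ∧ IsIntegral ℤ β ∧ (∀ γ : ℂ, IsConjRoot ℚ (β : ℂ) γ → γ ≠ (β : ℂ) → ‖γ‖ ≤ 1) ∧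
    ∃ γ : ℂ, IsConjRoot ℚ (β : ℂ) γ ∧ ‖γ‖ = 1

/-- The parameter set `Θ`. -/
def Theta : Set (ℝ × ℝ) :=
  {p | 0 < p.1 ∨ (p.1 = 0 ∧ 0 < p.2)}

/-- `φ(y, z; R) = exp ((log R) ^ (1 + y) * (log log R) ^ z)`, used for `R ≥ 3`
(where `log log R > 0`). -/
noncomputable def phi (y z R : ℝ) : ℝ :=
  Real.exp (Real.log R ^ (1 + y) * Real.log (Real.log R) ^ z)

/-- `ξ(y, z; X) = 1 + ∑_{m ≥ 3} X ^ ⌊φ(y, z; m)⌋`; the sum over `m ≥ 3` is indexed by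
`m = k + 3`. -/
noncomputable def xi (y z X : ℝ) : ℝ :=
  1 + ∑' k : ℕ, X ^ ⌊phi y z ((k + 3 : ℕ) : ℝ)⌋₊

end BetaSeries

/-! ### Arithmetic input: a norm lower bound, and a size bound at isolated coefficients -/

section

open Finset

/-! `Theta` is the set of lexicographically positive pairs, so after a swap `φ₁ = φ(y₁, z₁; ·)` may
be taken to grow more slowly than `φ₂`. Let `F` and `G` be the power series of `ξ₁` and `ξ₂`; `G` is
far sparser than `F`. A relation `P(ξ₁, ξ₂) = 0`, cleared of denominators and multiplied by `ξ₁`,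
becomes `∑ c n * β⁻¹ ^ n = 0` with integers `c n` of polynomial size. Its lexicographically leading
monomial, `F`-exponent first, is `F ^ (D + 1) * G ^ b`.

Arithmetic (`exists_pow_le_of_isolated`): suppose `c v > 0`, `c` vanishes on the `l - 1` places
before `v` and is nonnegative on the `l - 1` places after it. Unless `β ^ l` is already polynomial
in `v + l`, the tail from `v` is positive. Cutting the relation at `v - l` then gives a nonzero
algebraic integer of absolute value at most `β⁻¹ ^ l` times a polynomial in `v`. Its other
conjugates are polynomially bounded, since the other conjugates of `β` lie in the closed unit disc.
Its norm is at least `1`, so `β ^ l` is polynomially bounded in every case.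

Combinatorics (`exists_isolated_of_phi`): such `v` exist with `β ^ l` beyond any prescribed
polynomial. Below a suitable `N`, `F ^ (D + 1)` has more well-spaced exponents than `F ^ D * G ^ B`
has terms. One of them is thus far from every monomial of lower `F`-degree. Near it only `F ^ (D +
1) * G ^ i` with `i ≤ b` survive, and a shift by a large exponent of `G` leaves the powers `i < b`
behind. -/

theorem exists_one_le_abs_sum_mul_pow {β : ℝ} (hint : IsIntegral ℤ β)
    (hconj : ∀ γ : ℂ, IsConjRoot ℚ (β : ℂ) γ → γ ≠ (β : ℂ) → ‖γ‖ ≤ 1) :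
    ∃ d : ℕ, ∀ (c : ℕ → ℤ) (R : ℕ), ∑ n ∈ range (R + 1), (c n : ℝ) * β ^ (R - n) ≠ 0 →
      1 ≤ |∑ n ∈ range (R + 1), (c n : ℝ) * β ^ (R - n)| *
        (∑ n ∈ range (R + 1), |(c n : ℝ)|) ^ d := by
  classical
  have hintC : IsIntegral ℤ (β : ℂ) := hint.map (Complex.ofRealHom.toIntAlgHom)
  have hintQ : IsIntegral ℚ (β : ℂ) := hintC.tower_top
  let L := IntermediateField.adjoin ℚ {(β : ℂ)}
  have : FiniteDimensional ℚ L := IntermediateField.adjoin.finiteDimensional hintQ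
  let g : L := IntermediateField.AdjoinSimple.gen ℚ (β : ℂ)
  have hg : (g : ℂ) = β := IntermediateField.AdjoinSimple.coe_gen ℚ (β : ℂ)
  have hgint : IsIntegral ℤ g := by
    rw [← isIntegral_algebraMap_iff (B := ℂ) (algebraMap L ℂ).injective]
    exact hintC
  obtain ⟨σ₀, hσ₀⟩ : ∃ σ₀ : L →ₐ[ℚ] ℂ, σ₀ g = β := ⟨L.val, hg⟩
  -- The exponent counts the embeddings of `ℚ(β)` other than the identity; each contributes at most
  -- `∑ |c n|` to the norm.
  refine ⟨((univ : Finset (L →ₐ[ℚ] ℂ)).erase σ₀).card, fun c R hne => ?_⟩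
  set x : L := ∑ n ∈ range (R + 1), (c n : L) * g ^ (R - n) with hx
  have hxint : IsIntegral ℤ x := IsIntegral.sum _ fun n _ =>
    (isIntegral_algebraMap (R := ℤ) (x := c n)).mul (hgint.pow _)
  have hσ : ∀ σ : L →ₐ[ℚ] ℂ, σ x = ∑ n ∈ range (R + 1), (c n : ℂ) * σ g ^ (R - n) := by
    intro σ; simp [hx, map_sum]
  have hval : σ₀ x = ((∑ n ∈ range (R + 1), (c n : ℝ) * β ^ (R - n) : ℝ) : ℂ) := by
    rw [hσ, hσ₀]; push_cast; rfl
  have hx0 : x ≠ 0 := by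
    intro h
    rw [h, map_zero] at hval
    exact hne (by exact_mod_cast hval.symm)
  have hnorm : 1 ≤ ‖((Algebra.norm ℚ x : ℚ) : ℂ)‖ := by
    obtain ⟨k, hk⟩ := IsIntegrallyClosed.isIntegral_iff.mp (Algebra.isIntegral_norm ℚ hxint)
    have hk0 : k ≠ 0 := by
      rintro rfl
      exact (Algebra.norm_ne_zero_iff.mpr hx0) (by rw [← hk]; simp)
    rw [← hk]
    simp only [eq_intCast, Rat.cast_intCast, Complex.norm_intCast]
    exact_mod_cast Int.one_le_abs hk0
  have hprod := Algebra.norm_eq_prod_embeddings ℚ ℂ x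
  rw [eq_ratCast] at hprod
  rw [hprod, norm_prod, ← Finset.mul_prod_erase univ _ (mem_univ σ₀), hval,
    Complex.norm_real, Real.norm_eq_abs] at hnorm
  refine hnorm.trans (mul_le_mul_of_nonneg_left ?_ (abs_nonneg _))
  rw [← Finset.prod_const]
  refine Finset.prod_le_prod (fun _ _ => norm_nonneg _) fun σ hσ' => ?_
  have hγ : ‖σ g‖ ≤ 1 := by
    refine hconj _ ?_ ?_
    · rw [isConjRoot_iff_aeval_eq_zero hintQ]
      have h0 : Polynomial.aeval g (minpoly ℚ (β : ℂ)) = 0 := by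
        apply (algebraMap L ℂ).injective
        rw [← Polynomial.aeval_algebraMap_apply, map_zero]
        exact minpoly.aeval ℚ (β : ℂ)
      rw [Polynomial.aeval_algHom_apply, h0, map_zero]
    · intro h
      refine (Finset.mem_erase.mp hσ').1 ?_
      refine IntermediateField.algHom_ext_of_eq_adjoin (F := ℚ) rfl ?_
      rintro y hy
      obtain rfl : y = (β : ℂ) := hy
      exact h.trans hσ₀.symm
  rw [hσ]
  refine (norm_sum_le _ _).trans (Finset.sum_le_sum fun n _ => ?_)
  rw [norm_mul, norm_pow, Complex.norm_intCast]
  exact mul_le_of_le_one_right (abs_nonneg _) (pow_le_one₀ (norm_nonneg _) hγ)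

/-- The zeros before `v` allow the sum to be cut at `v - l` rather than `v - 1`, which gains the
factor `β⁻¹ ^ l`. Nonnegativity after `v` serves only to keep the tail from vanishing, as the norm
bound requires. -/
theorem exists_pow_le_of_isolated {β : ℝ} (hβ : 1 < β) {d : ℕ}
    (hd : ∀ (c : ℕ → ℤ) (R : ℕ), ∑ n ∈ range (R + 1), (c n : ℝ) * β ^ (R - n) ≠ 0 →
      1 ≤ |∑ n ∈ range (R + 1), (c n : ℝ) * β ^ (R - n)| *
        (∑ n ∈ range (R + 1), |(c n : ℝ)|) ^ d)
    {c : ℕ → ℤ} {C : ℝ} {k : ℕ} (hc : ∀ n, |(c n : ℝ)| ≤ C * ((n : ℝ) + 1) ^ k)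
    (hsum : HasSum (fun n => (c n : ℝ) * β⁻¹ ^ n) 0) :
    ∃ (C₀ : ℝ) (k₀ : ℕ), ∀ v l : ℕ, l ≤ v → 0 < c v →
      (∀ n, v < n + l → n < v → c n = 0) → (∀ n, v < n → n < v + l → 0 ≤ c n) →
      β ^ l ≤ C₀ * ((v : ℝ) + l + 1) ^ k₀ := by
  have hβ0 : 0 < β := by linarith
  have hx0 : 0 < β⁻¹ := by positivity
  have hx1 : β⁻¹ < 1 := inv_lt_one_of_one_lt₀ hβ
  have hC : 0 ≤ C := by simpa using (abs_nonneg _).trans (hc 0)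
  have hWs : Summable fun j : ℕ => ((j : ℝ) + 1) ^ k * β⁻¹ ^ j := by
    have h := (summable_nat_add_iff 1).mpr (summable_pow_mul_geometric_of_norm_lt_one k
      (r := β⁻¹) (by rw [Real.norm_eq_abs, abs_of_pos hx0]; exact hx1))
    refine (h.mul_left β).congr fun j => ?_
    rw [pow_succ]; push_cast; field_simp
  set W := ∑' j : ℕ, ((j : ℝ) + 1) ^ k * β⁻¹ ^ j with hW
  have hWpos : 0 ≤ W := tsum_nonneg fun j => by positivity
  have hterm : ∀ n j : ℕ, ‖(c (j + n) : ℝ) * β⁻¹ ^ j‖ ≤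
      C * ((n : ℝ) + 1) ^ k * (((j : ℝ) + 1) ^ k * β⁻¹ ^ j) := by
    intro n j
    rw [norm_mul, Real.norm_eq_abs, Real.norm_eq_abs, abs_of_pos (pow_pos hx0 j), ← mul_assoc]
    refine mul_le_mul_of_nonneg_right ((hc _).trans ?_) (by positivity)
    rw [mul_assoc, ← mul_pow]
    refine mul_le_mul_of_nonneg_left (pow_le_pow_left₀ (by positivity) ?_ _) hC
    push_cast
    nlinarith [Nat.cast_nonneg (α := ℝ) n, Nat.cast_nonneg (α := ℝ) j]
  have hTs : ∀ n : ℕ, Summable fun j : ℕ => (c (j + n) : ℝ) * β⁻¹ ^ j := fun n =>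
    Summable.of_norm_bounded (hWs.mul_left _) (hterm n)
  set T : ℕ → ℝ := fun n => ∑' j : ℕ, (c (j + n) : ℝ) * β⁻¹ ^ j with hT
  have hTb : ∀ n, |T n| ≤ C * W * ((n : ℝ) + 1) ^ k := by
    intro n
    have := tsum_of_norm_bounded ((hWs.hasSum).mul_left (C * ((n : ℝ) + 1) ^ k)) (hterm n)
    rw [Real.norm_eq_abs] at this
    rw [← hW] at this
    linarith
  have hsplit : ∀ n l : ℕ, T n = ∑ j ∈ range l, (c (j + n) : ℝ) * β⁻¹ ^ j + β⁻¹ ^ l * T (l + n) := by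
    intro n l
    rw [hT]
    simp only
    rw [← (hTs n).sum_add_tsum_nat_add l, ← tsum_mul_left]
    congr 2
    ext j
    rw [pow_add, add_assoc]; ring
  have hT0 : T 0 = 0 := by simpa [hT] using hsum.tsum_eq
  -- The three summands of the constant serve, in turn, the case where `β ^ l` is already at most
  -- the tail bound, the norm argument, and `l = 0`.
  refine ⟨C * W + C * W * C ^ d + 1, k + (k + 1) * d, fun v l hlv hv hz hp => ?_⟩
  set y : ℝ := (v : ℝ) + l + 1 with hy
  have hy1 : 1 ≤ y := by rw [hy]; linarith [Nat.cast_nonneg (α := ℝ) v, Nat.cast_nonneg (α := ℝ) l]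
  have hykk : y ^ k ≤ y ^ (k + (k + 1) * d) := pow_le_pow_right₀ hy1 (Nat.le_add_right _ _)
  have hyk1 : 1 ≤ y ^ (k + (k + 1) * d) := one_le_pow₀ hy1
  have hCW : 0 ≤ C * W := mul_nonneg hC hWpos
  have hCWd : 0 ≤ C * W * C ^ d := mul_nonneg hCW (pow_nonneg hC _)
  rcases Nat.eq_zero_or_pos l with rfl | hl
  · rw [pow_zero]
    nlinarith
  by_cases hsmall : β ^ l ≤ C * W * y ^ k
  · nlinarith
  push Not at hsmall
  have hxl : β⁻¹ ^ l * β ^ l = 1 := by rw [← mul_pow, inv_mul_cancel₀ hβ0.ne', one_pow]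
  have hZpos : 0 < T v := by
    rw [hsplit v l]
    have h1 : (1 : ℝ) ≤ ∑ j ∈ range l, (c (j + v) : ℝ) * β⁻¹ ^ j := by
      have h0 : (1 : ℝ) ≤ (c (0 + v) : ℝ) * β⁻¹ ^ 0 := by
        rw [zero_add, pow_zero, mul_one]; exact_mod_cast hv
      refine h0.trans (Finset.single_le_sum (f := fun j => (c (j + v) : ℝ) * β⁻¹ ^ j)
        (fun j hj => ?_) (mem_range.mpr hl))
      have hj' := mem_range.mp hj
      refine mul_nonneg ?_ (by positivity)
      rcases Nat.eq_zero_or_pos j with rfl | hj0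
      · rw [zero_add]; exact_mod_cast hv.le
      · exact_mod_cast hp (j + v) (by omega) (by omega)
    have h2 : |β⁻¹ ^ l * T (l + v)| < 1 := by
      rw [abs_mul, abs_of_pos (pow_pos hx0 l), ← hxl]
      refine mul_lt_mul_of_pos_left (((hTb _).trans_eq ?_).trans_lt hsmall) (by positivity)
      rw [hy]; push_cast; ring
    linarith [(abs_lt.mp h2).1]
  have hsum0 : ∑ n ∈ range (v - l + 1), (c n : ℝ) * β ^ (v - l - n) = -(β⁻¹ ^ l * T v) := by
    have h1 := hsplit 0 v
    rw [hT0, add_zero] at h1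
    simp only [add_zero] at h1
    have h2 : ∑ j ∈ range v, (c j : ℝ) * β⁻¹ ^ j =
        ∑ j ∈ range (v - l + 1), (c j : ℝ) * β⁻¹ ^ j := by
      symm
      refine Finset.sum_subset (fun n hn => ?_) fun n hn hn' => ?_
      · rw [mem_range] at *; omega
      · rw [mem_range] at *
        rw [hz n (by omega) (by omega)]; simp
    have h3 : ∑ n ∈ range (v - l + 1), (c n : ℝ) * β ^ (v - l - n) =
        β ^ (v - l) * ∑ j ∈ range (v - l + 1), (c j : ℝ) * β⁻¹ ^ j := by
      rw [Finset.mul_sum]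
      refine Finset.sum_congr rfl fun n hn => ?_
      have : n ≤ v - l := Nat.lt_succ_iff.mp (mem_range.mp hn)
      rw [pow_sub₀ _ hβ0.ne' this, inv_pow]; ring
    have h4 : β ^ (v - l) * β⁻¹ ^ v = β⁻¹ ^ l := by
      conv_lhs => rw [← Nat.sub_add_cancel hlv, pow_add β⁻¹, ← mul_assoc]
      rw [Nat.sub_add_cancel hlv, ← mul_pow, mul_inv_cancel₀ hβ0.ne', one_pow, one_mul]
    rw [h3, ← h2]
    have : ∑ j ∈ range v, (c j : ℝ) * β⁻¹ ^ j = -(β⁻¹ ^ v * T v) := by linarith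
    rw [this, ← h4]; ring
  have hZ := hTb v
  rw [abs_of_pos hZpos] at hZ
  have hmain := hd c (v - l) (by rw [hsum0]; exact neg_ne_zero.mpr (by positivity))
  rw [hsum0, abs_neg, abs_of_pos (by positivity)] at hmain
  have hH : ∑ n ∈ range (v - l + 1), |(c n : ℝ)| ≤ C * y ^ (k + 1) := by
    have : ∀ n ∈ range (v - l + 1), |(c n : ℝ)| ≤ C * y ^ k := fun n hn => by
      refine (hc n).trans (mul_le_mul_of_nonneg_left (pow_le_pow_left₀ (by positivity) ?_ _) hC)
      have h5 : n ≤ v := by have := mem_range.mp hn; omega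
      have h6 : (n : ℝ) ≤ v := by exact_mod_cast h5
      rw [hy]; linarith [Nat.cast_nonneg (α := ℝ) l]
    refine (Finset.sum_le_card_nsmul _ _ _ this).trans ?_
    rw [card_range, nsmul_eq_mul, pow_succ]
    have h5 : v - l + 1 ≤ v + l + 1 := by omega
    have h6 : ((v - l + 1 : ℕ) : ℝ) ≤ y := by rw [hy]; exact_mod_cast h5
    calc ((v - l + 1 : ℕ) : ℝ) * (C * y ^ k) ≤ y * (C * y ^ k) :=
          mul_le_mul_of_nonneg_right h6 (by positivity)
      _ = _ := by ring
  have hyv : (v : ℝ) + 1 ≤ y := by rw [hy]; linarith [Nat.cast_nonneg (α := ℝ) l]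
  have hfin : β ^ l ≤ T v * (∑ n ∈ range (v - l + 1), |(c n : ℝ)|) ^ d := by
    have := mul_le_mul_of_nonneg_left hmain (pow_pos hβ0 l).le
    calc β ^ l = β ^ l * 1 := (mul_one _).symm
      _ ≤ _ := this
      _ = (β⁻¹ ^ l * β ^ l) * (T v * (∑ n ∈ range (v - l + 1), |(c n : ℝ)|) ^ d) := by ring
      _ = _ := by rw [hxl, one_mul]
  calc β ^ l ≤ _ := hfin
    _ ≤ (C * W * y ^ k) * (C * y ^ (k + 1)) ^ d := by
        refine mul_le_mul (hZ.trans (mul_le_mul_of_nonneg_left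
          (pow_le_pow_left₀ (by positivity) hyv _) hCW)) (pow_le_pow_left₀
          (Finset.sum_nonneg fun _ _ => abs_nonneg _) hH _)
          (pow_nonneg (Finset.sum_nonneg fun _ _ => abs_nonneg _) _) (by positivity)
    _ = C * W * C ^ d * y ^ (k + (k + 1) * d) := by rw [mul_pow, ← pow_mul, pow_add]; ring
    _ ≤ _ := mul_le_mul_of_nonneg_right (by linarith) (by positivity)

end

/-! ### Power series with natural coefficients: evaluation, supports, partial sums -/

section

open Finset

namespace PowerSeries

/-- The generating series `1 + ∑ k, X ^ a k` of a sequence of exponents. -/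
noncomputable def ofExponents (a : ℕ → ℕ) : PowerSeries ℕ :=
  1 + PowerSeries.mk fun n => Nat.card (a ⁻¹' {n})

/-- The sum of the coefficients of index at most `N`. -/
noncomputable def partialSum (F : PowerSeries ℕ) (N : ℕ) : ℕ :=
  ∑ n ∈ range (N + 1), coeff n F

theorem hasSum_ofExponents {a : ℕ → ℕ} {x : ℝ} (hs : Summable fun k => x ^ a k) :
    HasSum (fun n => ((coeff n (ofExponents a) : ℕ) : ℝ) * x ^ n) (1 + ∑' k, x ^ a k) := by
  have h1 : HasSum (fun n => ((coeff n (1 : PowerSeries ℕ) : ℕ) : ℝ) * x ^ n) 1 := by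
    have := hasSum_ite_eq (0 : ℕ) (1 : ℝ)
    convert this using 1
    funext n
    rw [coeff_one]; split_ifs with h <;> simp [h]
  have h2 := hs.hasSum.tsum_fiberwise a
  convert (h1.add h2) using 1
  funext n
  have h3 : ∑' b : (a ⁻¹' {n} : Set ℕ), x ^ a b = Nat.card (a ⁻¹' {n}) * x ^ n := by
    rw [← nsmul_eq_mul, ← tsum_const]
    exact tsum_congr fun b => by rw [b.2]
  rw [h3, ofExponents, map_add, coeff_mk]
  push_cast; ring

theorem hasSum_mul {F G : PowerSeries ℕ} {x u v : ℝ} (hx : 0 ≤ x)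
    (hF : HasSum (fun n => ((coeff n F : ℕ) : ℝ) * x ^ n) u)
    (hG : HasSum (fun n => ((coeff n G : ℕ) : ℝ) * x ^ n) v) :
    HasSum (fun n => ((coeff n (F * G) : ℕ) : ℝ) * x ^ n) (u * v) := by
  have hn : ∀ F : PowerSeries ℕ, (fun n => ‖((coeff n F : ℕ) : ℝ) * x ^ n‖) =
      fun n => ((coeff n F : ℕ) : ℝ) * x ^ n := fun F => funext fun n =>
    Real.norm_of_nonneg (by positivity)
  have hF' := hF.summable
  have hG' := hG.summable
  rw [← hn] at hF' hG'
  have hs := summable_norm_sum_mul_antidiagonal_of_summable_norm hF' hG'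
  have ht := tsum_mul_tsum_eq_tsum_sum_antidiagonal_of_summable_norm hF' hG'
  rw [hF.tsum_eq, hG.tsum_eq] at ht
  rw [ht]
  have h := hs.of_norm.hasSum
  have he : (fun n => ((coeff n (F * G) : ℕ) : ℝ) * x ^ n) = fun n =>
      ∑ kl ∈ antidiagonal n, ((coeff kl.1 F : ℕ) : ℝ) * x ^ kl.1 *
        (((coeff kl.2 G : ℕ) : ℝ) * x ^ kl.2) := by
    funext n
    rw [coeff_mul]; push_cast
    rw [Finset.sum_mul]
    refine Finset.sum_congr rfl fun p hp => ?_
    rw [← mem_antidiagonal.mp hp, pow_add]; ring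
  rw [he]
  exact h

theorem hasSum_pow {F : PowerSeries ℕ} {x u : ℝ} (hx : 0 ≤ x)
    (hF : HasSum (fun n => ((coeff n F : ℕ) : ℝ) * x ^ n) u) (k : ℕ) :
    HasSum (fun n => ((coeff n (F ^ k) : ℕ) : ℝ) * x ^ n) (u ^ k) := by
  induction k with
  | zero =>
    have := hasSum_ite_eq (0 : ℕ) (1 : ℝ)
    rw [pow_zero, pow_zero]
    convert this using 1
    funext n
    rw [coeff_one]; split_ifs with h <;> simp [h]
  | succ k ih => rw [pow_succ, pow_succ]; exact hasSum_mul hx ih hF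

theorem le_coeff_mul (F G : PowerSeries ℕ) (i j : ℕ) :
    coeff i F * coeff j G ≤ coeff (i + j) (F * G) := by
  rw [coeff_mul]
  exact Finset.single_le_sum (f := fun p : ℕ × ℕ => coeff p.1 F * coeff p.2 G)
    (fun _ _ => Nat.zero_le _) (mem_antidiagonal.mpr rfl : (i, j) ∈ antidiagonal (i + j))

theorem coeff_mul_pos {F G : PowerSeries ℕ} {i j : ℕ} (hF : 0 < coeff i F) (hG : 0 < coeff j G) :
    0 < coeff (i + j) (F * G) :=
  (Nat.mul_pos hF hG).trans_le (le_coeff_mul F G i j)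

theorem coeff_le_coeff_pow_mul {F : PowerSeries ℕ} (hF : 0 < coeff 0 F) (G : PowerSeries ℕ)
    (n k : ℕ) : coeff n G ≤ coeff n (F ^ k * G) := by
  induction k with
  | zero => simp
  | succ k ih =>
    rw [pow_succ', mul_assoc]
    refine ih.trans ?_
    have := le_coeff_mul F (F ^ k * G) 0 n
    rw [zero_add] at this
    exact (Nat.le_mul_of_pos_left _ hF).trans this

/-- Positive constant terms make extra factors harmless, so supports are nested. Hence the single
product `F ^ D * G ^ B` controls all monomials of lower `F`-degree at once. -/
theorem coeff_pow_mul_pow_mono {F G : PowerSeries ℕ} (hF : 0 < coeff 0 F) (hG : 0 < coeff 0 G)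
    {a a' b b' : ℕ} (ha : a ≤ a') (hb : b ≤ b') (n : ℕ) :
    coeff n (F ^ a * G ^ b) ≤ coeff n (F ^ a' * G ^ b') := by
  obtain ⟨i, rfl⟩ := Nat.exists_eq_add_of_le ha
  obtain ⟨j, rfl⟩ := Nat.exists_eq_add_of_le hb
  have h : F ^ (a + i) * G ^ (b + j) = F ^ i * (G ^ j * (F ^ a * G ^ b)) := by ring
  rw [h]
  exact (coeff_le_coeff_pow_mul hG _ n j).trans (coeff_le_coeff_pow_mul hF _ n i)

/-- Partial sums bound both individual coefficients and the size of the support, so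
submultiplicativity handles both counts. -/
theorem partialSum_mul_le (F G : PowerSeries ℕ) (N : ℕ) :
    partialSum (F * G) N ≤ partialSum F N * partialSum G N := by
  unfold partialSum
  have h : ∀ n ∈ range (N + 1), coeff n (F * G) =
      ∑ p ∈ range (N + 1) ×ˢ range (N + 1) with p.1 + p.2 = n, coeff p.1 F * coeff p.2 G := by
    intro n hn
    rw [coeff_mul]
    refine Finset.sum_congr (Finset.ext fun p => ?_) fun _ _ => rfl
    simp only [HasAntidiagonal.mem_antidiagonal, mem_filter, mem_product, mem_range] at hn ⊢
    omega
  rw [Finset.sum_congr rfl h, Finset.sum_mul_sum, ← Finset.sum_product']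
  exact Finset.sum_fiberwise_le_sum_of_sum_fiber_nonneg fun _ _ => Nat.zero_le _

theorem partialSum_pow_le (F : PowerSeries ℕ) (N k : ℕ) :
    partialSum (F ^ k) N ≤ partialSum F N ^ k := by
  induction k with
  | zero => simp [partialSum, coeff_one]
  | succ k ih =>
    rw [pow_succ, pow_succ]
    exact (partialSum_mul_le _ _ _).trans (Nat.mul_le_mul_right _ ih)

theorem partialSum_pow_mul_pow_le (F G : PowerSeries ℕ) (N a b : ℕ) :
    partialSum (F ^ a * G ^ b) N ≤ partialSum F N ^ a * partialSum G N ^ b :=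
  (partialSum_mul_le _ _ _).trans (Nat.mul_le_mul (partialSum_pow_le _ _ _)
    (partialSum_pow_le _ _ _))

theorem card_filter_coeff_pos_le (F : PowerSeries ℕ) (N : ℕ) :
    #{n ∈ range (N + 1) | 0 < coeff n F} ≤ partialSum F N := by
  rw [Finset.card_filter]
  exact Finset.sum_le_sum fun n _ => by split_ifs with h <;> omega

theorem coeff_le_partialSum (F : PowerSeries ℕ) (n : ℕ) : coeff n F ≤ partialSum F n :=
  Finset.single_le_sum (f := fun n => coeff n F) (fun _ _ => Nat.zero_le _)
    (mem_range.mpr n.lt_succ_self)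

theorem coeff_zero_ofExponents_pos (a : ℕ → ℕ) : 0 < coeff 0 (ofExponents a) := by
  rw [ofExponents, map_add, coeff_one, if_pos rfl]; omega

theorem coeff_ofExponents_pos {a : ℕ → ℕ} (ha : Filter.Tendsto a Filter.atTop Filter.atTop)
    (k : ℕ) : 0 < coeff (a k) (ofExponents a) := by
  have hf : (a ⁻¹' {a k}).Finite := by
    have := ha.eventually (Filter.eventually_ne_atTop (a k))
    rw [← Nat.cofinite_eq_atTop, Filter.eventually_cofinite] at this
    refine this.subset fun n hn => ?_
    simpa using hn
  have : Finite (a ⁻¹' {a k}) := hf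
  have : Nonempty (a ⁻¹' {a k}) := ⟨⟨k, rfl⟩⟩
  rw [ofExponents, map_add, coeff_mk]
  have := Nat.card_pos (α := (a ⁻¹' {a k} : Set ℕ))
  omega

theorem partialSum_ofExponents_le {a : ℕ → ℕ} {N p : ℕ} (h : ∀ k, p ≤ k → N < a k) :
    partialSum (ofExponents a) N ≤ p + 1 := by
  have h1 : ∀ n ∈ range (N + 1), coeff n (ofExponents a) =
      (if n = 0 then 1 else 0) + #{k ∈ range p | a k = n} := by
    intro n hn
    rw [ofExponents, map_add, coeff_one, coeff_mk]
    congr 1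
    refine Nat.subtype_card _ fun k => ?_
    simp only [mem_filter, mem_range, Set.mem_preimage, Set.mem_singleton_iff]
    refine ⟨fun hk => hk.2, fun hk => ⟨?_, hk⟩⟩
    by_contra hp
    have := h k (not_lt.mp hp)
    have := mem_range.mp hn
    omega
  rw [partialSum, Finset.sum_congr rfl h1, Finset.sum_add_distrib]
  have h2 : ∑ n ∈ range (N + 1), #{k ∈ range p | a k = n} ≤ p := by
    have := Finset.sum_fiberwise_le_sum_of_sum_fiber_nonneg (s := range p) (t := range (N + 1))
      (g := a) (f := fun _ => 1) fun _ _ => Nat.zero_le _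
    simpa using this
  have h3 : ∑ n ∈ range (N + 1), (if n = 0 then 1 else 0) = 1 := by simp
  omega

end PowerSeries

end

/-! ### Combinatorics of gaps: spaced sets and isolated exponents -/

section

open Finset

/-- Distinct elements of `V` have distance at least `s`. -/
def Finset.IsSpaced (s : ℕ) (V : Finset ℕ) : Prop :=
  ∀ u ∈ V, ∀ v ∈ V, u < v → u + s ≤ v

theorem Finset.IsSpaced.image_add {s U : ℕ} {A V : Finset ℕ} (hs : 0 < s)
    (hA : A.IsSpaced (U + s)) (hV : V.IsSpaced s) (hU : ∀ v ∈ V, v ≤ U) :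
    ((A ×ˢ V).image fun p => p.1 + p.2).IsSpaced s ∧
      #((A ×ˢ V).image fun p => p.1 + p.2) = #A * #V := by
  constructor
  · intro x hx y hy hxy
    simp only [mem_image, mem_product, Prod.exists] at hx hy
    obtain ⟨a, u, ⟨ha, hu⟩, rfl⟩ := hx
    obtain ⟨b, v, ⟨hb, hv⟩, rfl⟩ := hy
    have := hU u hu
    have := hU v hv
    rcases lt_trichotomy a b with h | rfl | h
    · have := hA a ha b hb h; omega
    · have := hV u hu v hv (by omega); omega
    · have := hA b hb a ha h; omega
  · rw [card_image_of_injOn, card_product]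
    rintro ⟨a, u⟩ hau ⟨b, v⟩ hbv h
    simp only [coe_product, Set.mem_prod, mem_coe] at hau hbv
    have := hU u hau.2
    have := hU v hbv.2
    dsimp only at h
    rcases lt_trichotomy a b with h' | rfl | h'
    · have := hA a hau.1 b hbv.1 h'; omega
    · rw [Nat.add_left_cancel h]
    · have := hA b hbv.1 a hau.1 h'; omega

/-- Climb through `S` while some larger element is closer than `g`: each step is shorter than `g`,
and there are at most `#S` of them. -/
theorem Finset.exists_mem_gap_above (S : Finset ℕ) (g : ℕ) {w₀ : ℕ} (hw₀ : w₀ ∈ S) :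
    ∃ w ∈ S, w₀ ≤ w ∧ w ≤ w₀ + #S * g ∧ ∀ n ∈ S, w < n → w + g ≤ n := by
  suffices h : ∀ k, ∀ w₀ ∈ S, #{n ∈ S | w₀ < n} ≤ k →
      ∃ w ∈ S, w₀ ≤ w ∧ w ≤ w₀ + k * g ∧ ∀ n ∈ S, w < n → w + g ≤ n from
    h #S w₀ hw₀ (card_filter_le _ _)
  intro k
  induction k with
  | zero =>
    intro w hw hk
    refine ⟨w, hw, le_rfl, by omega, fun n hn hwn => ?_⟩
    have := card_eq_zero.mp (Nat.le_zero.mp hk)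
    exact absurd (mem_filter.mpr ⟨hn, hwn⟩) (this ▸ notMem_empty n)
  | succ k ih =>
    intro w hw hk
    by_cases h : ∀ n ∈ S, w < n → w + g ≤ n
    · exact ⟨w, hw, le_rfl, Nat.le_add_right _ _, h⟩
    push Not at h
    obtain ⟨n, hn, hwn, hng⟩ := h
    have hlt : #{m ∈ S | n < m} < #{m ∈ S | w < m} := by
      refine card_lt_card (ssubset_iff_of_subset (fun m hm => ?_) |>.mpr ⟨n, ?_, ?_⟩)
      · rw [mem_filter] at *; exact ⟨hm.1, hwn.trans hm.2⟩
      · exact mem_filter.mpr ⟨hn, hwn⟩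
      · simp
    obtain ⟨w', hw', h1, h2, h3⟩ := ih n hn (by omega)
    refine ⟨w', hw', by omega, ?_, h3⟩
    rw [Nat.succ_mul]; omega

theorem Finset.exists_mem_gap_below (S : Finset ℕ) (g : ℕ) {w₀ : ℕ} (hw₀ : w₀ ∈ S) :
    ∃ w ∈ S, w ≤ w₀ ∧ w₀ ≤ w + #S * g ∧ ∀ n ∈ S, n < w → n + g ≤ w := by
  suffices h : ∀ k, ∀ w₀ ∈ S, #{n ∈ S | n < w₀} ≤ k →
      ∃ w ∈ S, w ≤ w₀ ∧ w₀ ≤ w + k * g ∧ ∀ n ∈ S, n < w → n + g ≤ w from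
    h #S w₀ hw₀ (card_filter_le _ _)
  intro k
  induction k with
  | zero =>
    intro w hw hk
    refine ⟨w, hw, le_rfl, by omega, fun n hn hwn => ?_⟩
    have := card_eq_zero.mp (Nat.le_zero.mp hk)
    exact absurd (mem_filter.mpr ⟨hn, hwn⟩) (this ▸ notMem_empty n)
  | succ k ih =>
    intro w hw hk
    by_cases h : ∀ n ∈ S, n < w → n + g ≤ w
    · exact ⟨w, hw, le_rfl, Nat.le_add_right _ _, h⟩
    push Not at h
    obtain ⟨n, hn, hwn, hng⟩ := h
    have hlt : #{m ∈ S | m < n} < #{m ∈ S | m < w} := by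
      refine card_lt_card (ssubset_iff_of_subset (fun m hm => ?_) |>.mpr ⟨n, ?_, ?_⟩)
      · rw [mem_filter] at *; exact ⟨hm.1, hm.2.trans hwn⟩
      · exact mem_filter.mpr ⟨hn, hwn⟩
      · simp
    obtain ⟨w', hw', h1, h2, h3⟩ := ih n hn (by omega)
    refine ⟨w', hw', by omega, ?_, h3⟩
    rw [Nat.succ_mul]; omega

/-- A spaced set with more elements than `T` has an element far away from all of `T`. -/
theorem Finset.IsSpaced.exists_far {L : ℕ} {V T : Finset ℕ} (hV : V.IsSpaced (2 * L))
    (hcard : #T < #V) : ∃ v ∈ V, ∀ n ∈ T, n + L ≤ v ∨ v + L ≤ n := by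
  by_contra! h
  -- Pigeonhole: two elements of `V` near the same element of `T` would be less than `2 * L` apart.
  choose! f hf hf' using h
  obtain ⟨u, hu, v, hv, huv, he⟩ := exists_ne_map_eq_of_card_lt_of_maps_to hcard hf
  have h1 := hf' u hu
  have h2 := hf' v hv
  rcases lt_or_gt_of_ne huv with h | h
  · have := hV u hu v hv h; omega
  · have := hV v hv u hu h; omega

namespace PowerSeries

/-- Take sums of one `A m` from each of the scales `K ^ (e + i + 1) ≤ m < 2 * K ^ (e + i + 1)`, `i <
j`. At each scale the gaps of `A` exceed the diameter of all sums from lower scales plus `s`, so the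
sums are distinct and stay spaced, and the cardinalities multiply. -/
theorem exists_isSpaced_coeff_pow_pos {F : PowerSeries ℕ} {A : ℕ → ℕ} {K e s D : ℕ} (hs : 0 < s)
    (hA : ∀ m, K ^ (e + 1) ≤ m → 0 < coeff (A m) F)
    (hgap : ∀ j < D, ∀ m, K ^ (e + j + 1) ≤ m → A m + 3 * A (2 * K ^ (e + j)) ≤ A (m + 1))
    (hK : 0 < K) (hsA : s ≤ A (2 * K ^ e)) :
    ∀ j ≤ D, ∃ V : Finset ℕ, (∀ v ∈ V, 0 < coeff v (F ^ j)) ∧ V.IsSpaced s ∧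
      (∀ v ∈ V, v ≤ 2 * A (2 * K ^ (e + j))) ∧ K ^ ((e + 1) * j) ≤ #V ∧
      s ≤ A (2 * K ^ (e + j)) := by
  intro j
  induction j with
  | zero =>
    intro _
    refine ⟨{0}, by simp, ?_, by simp, by simp, hsA⟩
    intro u hu v hv h
    rw [mem_singleton] at hu hv; omega
  | succ j ih =>
    intro hj
    obtain ⟨V, hV1, hV2, hV3, hV4, hV5⟩ := ih (by omega)
    have hg := hgap j (by omega)
    set M := K ^ (e + j + 1) with hM
    have hMpos : 0 < M := pow_pos hK _
    have hstep : ∀ i m, M ≤ m → A m + (i + 1) * (3 * A (2 * K ^ (e + j))) ≤ A (m + (i + 1)) := by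
      intro i m hm
      induction i with
      | zero => simpa using hg m hm
      | succ i ih =>
        have := hg (m + (i + 1)) (by omega)
        rw [Nat.succ_mul, ← Nat.add_assoc m (i + 1) 1]; omega
    have hlt : ∀ m n, M ≤ m → m < n → A m + 3 * A (2 * K ^ (e + j)) ≤ A n := by
      intro m n hm hmn
      obtain ⟨i, rfl⟩ := Nat.exists_eq_add_of_lt hmn
      have := hstep i m hm
      have h2 : 1 * (3 * A (2 * K ^ (e + j))) ≤ (i + 1) * (3 * A (2 * K ^ (e + j))) :=
        Nat.mul_le_mul_right _ (by omega)
      rw [Nat.add_assoc m i 1]; omega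
    have hbig := hlt M (2 * M) le_rfl (by omega)
    set S := (Ico M (2 * M)).image A with hS
    have hinj : Set.InjOn A (Ico M (2 * M) : Set ℕ) := by
      intro m hm n hn h
      simp only [coe_Ico, Set.mem_Ico] at hm hn
      rcases lt_trichotomy m n with h' | h' | h'
      · have := hlt m n hm.1 h'; omega
      · exact h'
      · have := hlt n m hn.1 h'; omega
    have hScard : #S = M := by rw [hS, card_image_of_injOn hinj, Nat.card_Ico]; omega
    have hSsp : S.IsSpaced (2 * A (2 * K ^ (e + j)) + s) := by
      intro x hx y hy hxy
      obtain ⟨m, hm, rfl⟩ := mem_image.mp hx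
      obtain ⟨n, hn, rfl⟩ := mem_image.mp hy
      rw [mem_Ico] at hm hn
      rcases lt_trichotomy m n with h' | rfl | h'
      · have := hlt m n hm.1 h'; omega
      · omega
      · have := hlt n m hn.1 h'; omega
    obtain ⟨h1, h2⟩ := hSsp.image_add hs hV2 hV3
    refine ⟨_, ?_, h1, ?_, ?_, ?_⟩
    · intro x hx
      simp only [mem_image, mem_product, Prod.exists] at hx
      obtain ⟨a, v, ⟨ha, hv⟩, rfl⟩ := hx
      obtain ⟨m, hm, rfl⟩ := mem_image.mp ha
      rw [pow_succ']
      refine coeff_mul_pos (hA m ?_) (hV1 v hv)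
      exact (Nat.pow_le_pow_right hK (by omega)).trans (mem_Ico.mp hm).1
    · intro x hx
      simp only [mem_image, mem_product, Prod.exists] at hx
      obtain ⟨a, v, ⟨ha, hv⟩, rfl⟩ := hx
      obtain ⟨m, hm, rfl⟩ := mem_image.mp ha
      have h3 := hV3 v hv
      have h4 := hlt m (2 * M) (mem_Ico.mp hm).1 (mem_Ico.mp hm).2
      rw [← Nat.add_assoc e j 1, ← hM]; omega
    · rw [h2, hScard, Nat.mul_add_one, pow_add, mul_comm]
      exact Nat.mul_le_mul (Nat.pow_le_pow_right hK (by omega)) hV4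
    · rw [← Nat.add_assoc e j 1, ← hM]; omega

/-- Three moves: choose `v₀ ∈ V` at distance at least `L` from the support of `F ^ D * G ^ B`;
escape the lower powers of `G` by adding `t`; descend to the start of a cluster. `L` is large enough
that all of this stays near `v₀`. -/
theorem exists_isolated {F G : PowerSeries ℕ} (hF : 0 < coeff 0 F) (hG : 0 < coeff 0 G)
    {D B b N L M l t : ℕ} {V : Finset ℕ} (hbB : b ≤ B) (hl : 0 < l)
    (hV1 : ∀ v ∈ V, 0 < coeff v (F ^ (D + 1))) (hV2 : V.IsSpaced (2 * L))
    (hV3 : ∀ v ∈ V, v + L ≤ N) (hV4 : partialSum (F ^ D * G ^ B) N < #V)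
    (hM : partialSum (F ^ (D + 1) * G ^ B) N ≤ M) (ht : 0 < coeff t G)
    (htl : (M + 2) * l ≤ t) (hL : (M + 1) * (t + l) ≤ L) :
    ∃ v, l ≤ v ∧ v + l ≤ N ∧ 0 < coeff v (F ^ (D + 1) * G ^ b) ∧
      (∀ n, v < n + l → n < v + l → coeff n (F ^ D * G ^ B) = 0) ∧
      (∀ n, v < n + l → n < v + l → ∀ i < b, coeff n (F ^ (D + 1) * G ^ i) = 0) ∧
      (∀ n, v < n + l → n < v → coeff n (F ^ (D + 1) * G ^ b) = 0) := by
  obtain ⟨v₀, hv₀, hfar⟩ := hV2.exists_far ((card_filter_coeff_pos_le _ _).trans_lt hV4)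
  have hT1 : ∀ n, v₀ < n + L → n < v₀ + L → coeff n (F ^ D * G ^ B) = 0 := by
    intro n h1 h2
    by_contra hne
    have := hfar n (mem_filter.mpr ⟨mem_range.mpr (by have := hV3 v₀ hv₀; omega),
      Nat.pos_of_ne_zero hne⟩)
    omega
  have h00 : 0 < coeff 0 (F ^ D * G ^ B) := by
    have := coeff_pow_mul_pow_mono hF hG (Nat.zero_le D) (Nat.zero_le B) 0
    rw [pow_zero, pow_zero, mul_one, coeff_one, if_pos rfl] at this
    omega
  have hLpos : 0 < L := by
    refine lt_of_lt_of_le ?_ hL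
    positivity
  have hLv : L ≤ v₀ := by
    by_contra h
    exact h00.ne' (hT1 0 (by omega) (by omega))
  have hvN := hV3 v₀ hv₀
  have hcard : ∀ i ≤ B, #{n ∈ range (N + 1) | 0 < coeff n (F ^ (D + 1) * G ^ i)} ≤ M := by
    intro i hi
    refine (card_filter_coeff_pos_le _ _).trans (le_trans ?_ hM)
    exact sum_le_sum fun n _ => coeff_pow_mul_pow_mono hF hG le_rfl hi n
  have hMl : M * l + 2 * l ≤ t := by rw [← Nat.add_mul]; exact htl
  have hL' : M * (t + l) + (t + l) ≤ L := by rw [← Nat.succ_mul]; exact hL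
  have hMtl : M * l ≤ M * (t + l) := Nat.mul_le_mul_left _ (Nat.le_add_left _ _)
  obtain ⟨x, hxpos, hxN, hx0, hx1, hx2⟩ : ∃ x, 0 < coeff x (F ^ (D + 1) * G ^ b) ∧ x + l ≤ N ∧
      v₀ ≤ x ∧ x + l ≤ v₀ + L ∧
      ∀ n, x < n + M * l + 2 * l → n < x + l → ∀ i < b, coeff n (F ^ (D + 1) * G ^ i) = 0 := by
    rcases b with _ | b
    · refine ⟨v₀, by simpa using hV1 v₀ hv₀, by omega, le_rfl, by omega, fun n _ _ i hi => ?_⟩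
      exact absurd hi (Nat.not_lt_zero i)
    obtain ⟨w, hw, h1, h2, h3⟩ :=
      ({n ∈ range (N + 1) | 0 < coeff n (F ^ (D + 1) * G ^ b)} : Finset ℕ).exists_mem_gap_above
        (t + l) (w₀ := v₀) (mem_filter.mpr ⟨mem_range.mpr (by omega), by
          have := coeff_pow_mul_pow_mono hF hG (le_refl (D + 1)) (Nat.zero_le b) v₀
          rw [pow_zero, mul_one] at this
          exact (hV1 v₀ hv₀).trans_le this⟩)
    have h4 := Nat.mul_le_mul_right (t + l) (hcard b (by omega))
    -- No exponent of `F ^ (D + 1) * G ^ b`, here one power below the leading one, lies strictly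
    -- between `w` and `w + t + l`, while `w + t` is an exponent of the next power.
    refine ⟨w + t, ?_, by omega, by omega, by omega, fun n hn1 hn2 i hi => ?_⟩
    · rw [pow_succ G, ← mul_assoc]
      exact coeff_mul_pos (mem_filter.mp hw).2 ht
    · by_contra hne
      have := coeff_pow_mul_pow_mono hF hG (le_refl (D + 1)) (Nat.lt_succ_iff.mp hi) n
      have := h3 n (mem_filter.mpr ⟨mem_range.mpr (by omega), by omega⟩) (by omega)
      omega
  -- The descent costs at most `M * l`; since `t ≥ (M + 2) * l`, the window around `v` remains above
  -- `w`.
  obtain ⟨v, hv, h1, h2, h3⟩ :=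
    ({n ∈ range (N + 1) | 0 < coeff n (F ^ (D + 1) * G ^ b)} : Finset ℕ).exists_mem_gap_below
      l (w₀ := x) (mem_filter.mpr ⟨mem_range.mpr (by omega), hxpos⟩)
  have h4 := Nat.mul_le_mul_right l (hcard b hbB)
  refine ⟨v, by omega, by omega, (mem_filter.mp hv).2, fun n hn1 hn2 => hT1 n (by omega) (by omega),
    fun n hn1 hn2 => hx2 n (by omega) (by omega), fun n hn1 hn2 => ?_⟩
  by_contra hne
  have := h3 n (mem_filter.mpr ⟨mem_range.mpr (by omega), Nat.pos_of_ne_zero hne⟩) hn2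
  omega

end PowerSeries

end

/-! ### Growth of `φ` -/

section

open Filter Topology

namespace BetaSeries

/-- The logarithm of `phi y z R` as a function of `u = log R`. -/
noncomputable def logPhi (y z u : ℝ) : ℝ := u ^ (1 + y) * Real.log u ^ z

theorem phi_eq_exp_logPhi (y z R : ℝ) : phi y z R = Real.exp (logPhi y z (Real.log R)) := rfl

theorem phi_pos (y z R : ℝ) : 0 < phi y z R := Real.exp_pos _

theorem tendsto_rpow_mul_log_rpow {y z : ℝ} (h : (y, z) ∈ Theta) :
    Tendsto (fun u : ℝ => u ^ y * Real.log u ^ z) atTop atTop := by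
  rcases h with h | ⟨h, hz⟩
  · change 0 < y at h
    have h1 := isLittleO_log_rpow_rpow_atTop (-z) h
    have h2 : Tendsto (fun u : ℝ => Real.log u ^ (-z) / u ^ y) atTop (𝓝[>] 0) := by
      refine tendsto_nhdsWithin_iff.mpr ⟨h1.tendsto_div_nhds_zero, ?_⟩
      filter_upwards [eventually_gt_atTop 1] with u hu
      have := Real.log_pos hu
      exact div_pos (Real.rpow_pos_of_pos this _) (Real.rpow_pos_of_pos (by linarith) _)
    refine (tendsto_inv_nhdsGT_zero.comp h2).congr' ?_
    filter_upwards [eventually_gt_atTop 1] with u hu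
    have := Real.log_pos hu
    rw [Function.comp_apply, inv_div, Real.rpow_neg this.le, div_inv_eq_mul]
  · change y = 0 at h
    change 0 < z at hz
    subst h
    simp only [Real.rpow_zero, one_mul]
    exact (tendsto_rpow_atTop hz).comp Real.tendsto_log_atTop

/-- The delicate case is `z < 0 < y`: the function is then `(log u / u ^ (y / -z)) ^ z`, a negative
power of an eventually decreasing function. -/
theorem exists_monotoneOn_rpow_mul_log_rpow {y z : ℝ} (h : (y, z) ∈ Theta) :
    ∃ u₀ : ℝ, MonotoneOn (fun u : ℝ => u ^ y * Real.log u ^ z) (Set.Ici u₀) := by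
  have hy : 0 ≤ y := by
    rcases h with h | ⟨h, -⟩
    · exact le_of_lt h
    · exact le_of_eq (Eq.symm h)
  rcases le_or_gt 0 z with hz | hz
  · refine ⟨1, fun u hu v hv huv => ?_⟩
    have hu' : (1 : ℝ) ≤ u := hu
    have h0 := Real.log_nonneg hu'
    have h1 := Real.log_le_log (by linarith) huv
    exact mul_le_mul (Real.rpow_le_rpow (by linarith) huv hy) (Real.rpow_le_rpow h0 h1 hz)
      (Real.rpow_nonneg h0 _) (Real.rpow_nonneg (by linarith) _)
  · have hy' : 0 < y := by
      rcases h with h | ⟨-, h⟩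
      · exact h
      · exact absurd h (not_lt.mpr hz.le)
    have ha : 0 < y / (-z) := div_pos hy' (by linarith)
    have hm := Real.log_div_self_rpow_antitoneOn ha
    have key : ∀ u : ℝ, 1 < u → u ^ y * Real.log u ^ z = (Real.log u / u ^ (y / (-z))) ^ z := by
      intro u hu
      have hu0 : 0 < u := by linarith
      have hl := Real.log_pos hu
      rw [Real.div_rpow hl.le (Real.rpow_nonneg hu0.le _), ← Real.rpow_mul hu0.le]
      have : y / (-z) * z = -y := by
        rw [div_mul_eq_mul_div, div_neg, mul_div_assoc, div_self hz.ne, mul_one]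
      rw [this, Real.rpow_neg hu0.le, div_inv_eq_mul, mul_comm]
    refine ⟨max 2 (Real.exp (y / (-z))⁻¹), fun u hu v hv huv => ?_⟩
    have hu' := max_le_iff.mp (Set.mem_Ici.mp hu)
    have hv' := max_le_iff.mp (Set.mem_Ici.mp hv)
    simp only
    rw [key u (by linarith), key v (by linarith)]
    refine Real.rpow_le_rpow_of_nonpos ?_ (hm hu'.2 hv'.2 huv) hz.le
    exact div_pos (Real.log_pos (by linarith)) (Real.rpow_pos_of_pos (by linarith) _)

theorem logPhi_eq {y z u : ℝ} (hu : 0 < u) : logPhi y z u = u * (u ^ y * Real.log u ^ z) := by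
  rw [logPhi, Real.rpow_add hu, Real.rpow_one, mul_assoc]

theorem logPhi_nonneg {y z u : ℝ} (hu : 1 ≤ u) : 0 ≤ logPhi y z u :=
  mul_nonneg (Real.rpow_nonneg (by linarith) _) (Real.rpow_nonneg (Real.log_nonneg hu) _)

theorem exists_logPhi_add_le {y z : ℝ} (h : (y, z) ∈ Theta) (c : ℝ) :
    ∃ u₀ : ℝ, 1 ≤ u₀ ∧ ∀ u v : ℝ, u₀ ≤ u → u ≤ v →
      logPhi y z u + c * (v - u) ≤ logPhi y z v := by
  obtain ⟨u₁, h1⟩ := exists_monotoneOn_rpow_mul_log_rpow h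
  obtain ⟨u₂, h2⟩ := eventually_atTop.mp ((tendsto_rpow_mul_log_rpow h).eventually_ge_atTop c)
  refine ⟨max 1 (max u₁ u₂), le_max_left _ _, fun u v hu huv => ?_⟩
  obtain ⟨hu1, hu2⟩ := max_le_iff.mp hu
  obtain ⟨hu2, hu3⟩ := max_le_iff.mp hu2
  have h3 := h1 (Set.mem_Ici.mpr hu2) (Set.mem_Ici.mpr (hu2.trans huv)) huv
  have h4 := h2 u hu3
  simp only at h3
  rw [logPhi_eq (by linarith), logPhi_eq (by linarith)]
  nlinarith

/-- With `u = log R`, scaling `u` by `c` means replacing `R` by `R ^ c`: powers of the argument cost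
only a constant factor in `log φ`. -/
theorem exists_logPhi_le_mul {y z c : ℝ} (hy : 0 ≤ y) (hc : 1 ≤ c) :
    ∃ C : ℝ, 1 ≤ C ∧ ∀ᶠ u in atTop, ∀ v, u ≤ v → v ≤ c * u → logPhi y z v ≤ C * logPhi y z u := by
  refine ⟨c ^ (1 + y) * 2 ^ |z|, ?_, ?_⟩
  · have h1 : 1 ≤ c ^ (1 + y) := Real.one_le_rpow hc (by linarith)
    have h2 : (1 : ℝ) ≤ 2 ^ |z| := Real.one_le_rpow one_le_two (abs_nonneg _)
    nlinarith
  filter_upwards [eventually_ge_atTop c, eventually_gt_atTop 1] with u huc hu v huv hv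
  have hu0 : 0 < u := by linarith
  have hl := Real.log_pos hu
  have hl1 : Real.log u ≤ Real.log v := Real.log_le_log hu0 huv
  have hl2 : Real.log v ≤ 2 * Real.log u := by
    have := Real.log_le_log (by linarith) (hv.trans (mul_le_mul_of_nonneg_right huc hu0.le))
    rw [Real.log_mul hu0.ne' hu0.ne'] at this
    linarith
  have h1 : v ^ (1 + y) ≤ c ^ (1 + y) * u ^ (1 + y) := by
    rw [← Real.mul_rpow (by linarith) hu0.le]
    exact Real.rpow_le_rpow (by linarith) hv (by linarith)
  have h2 : Real.log v ^ z ≤ 2 ^ |z| * Real.log u ^ z := by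
    rcases le_or_gt 0 z with hz | hz
    · rw [abs_of_nonneg hz, ← Real.mul_rpow zero_le_two hl.le]
      exact Real.rpow_le_rpow (hl.le.trans hl1) hl2 hz
    · refine (Real.rpow_le_rpow_of_nonpos hl hl1 hz.le).trans ?_
      exact le_mul_of_one_le_left (Real.rpow_nonneg hl.le _)
        (Real.one_le_rpow one_le_two (abs_nonneg _))
  rw [logPhi, logPhi]
  calc _ ≤ (c ^ (1 + y) * u ^ (1 + y)) * (2 ^ |z| * Real.log u ^ z) :=
        mul_le_mul h1 h2 (Real.rpow_nonneg (hl.le.trans hl1) _) (by positivity)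
    _ = _ := by ring

theorem logPhi_isLittleO_exp (y z : ℝ) : logPhi y z =o[atTop] Real.exp := by
  have h1 : (fun u : ℝ => u ^ (1 + y) * Real.log u ^ z) =o[atTop]
      fun u : ℝ => u ^ (1 + y) * u ^ (1 : ℝ) :=
    (Asymptotics.isBigO_refl _ _).mul_isLittleO (isLittleO_log_rpow_rpow_atTop z one_pos)
  have h2 : (fun u : ℝ => u ^ (1 + y) * u ^ (1 : ℝ)) =ᶠ[atTop] fun u => u ^ (1 + y + 1) := by
    filter_upwards [eventually_gt_atTop 0] with u hu
    rw [← Real.rpow_add hu]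
  refine (h1.trans_eventuallyEq h2).trans ?_
  simpa using isLittleO_rpow_exp_pos_mul_atTop (1 + y + 1) one_pos

theorem tendsto_log_natCast : Tendsto (fun m : ℕ => Real.log m) atTop atTop :=
  Real.tendsto_log_atTop.comp tendsto_natCast_atTop_atTop

theorem exists_phi_mul_pow_le {y z : ℝ} (h : (y, z) ∈ Theta) (c : ℕ) :
    ∃ m₀ : ℕ, 3 ≤ m₀ ∧ ∀ m n : ℕ, m₀ ≤ m → m ≤ n →
      phi y z m * (n : ℝ) ^ c ≤ phi y z n * (m : ℝ) ^ c := by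
  obtain ⟨u₀, -, h0⟩ := exists_logPhi_add_le h c
  obtain ⟨m₀, hm₀⟩ := eventually_atTop.mp (tendsto_log_natCast.eventually_ge_atTop u₀)
  refine ⟨max 3 m₀, le_max_left _ _, fun m n hm hmn => ?_⟩
  obtain ⟨h3, hm⟩ := max_le_iff.mp hm
  have hm0 : (0 : ℝ) < m := by exact_mod_cast (by omega : 0 < m)
  have hmn' : (m : ℝ) ≤ n := by exact_mod_cast hmn
  have hn0 : (0 : ℝ) < n := hm0.trans_le hmn'
  have h1 := h0 _ _ (hm₀ m hm) (Real.log_le_log hm0 hmn')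
  rw [phi_eq_exp_logPhi, phi_eq_exp_logPhi, ← Real.exp_log hm0, ← Real.exp_log hn0,
    ← Real.exp_nat_mul, ← Real.exp_nat_mul, ← Real.exp_add, ← Real.exp_add]
  simp only [Real.log_exp]
  exact Real.exp_le_exp.mpr (by linarith)

/-- As `φ(m) / m` is eventually nondecreasing, `φ(m + 1) - φ(m) ≥ φ(m) / m ≥ φ(K ^ (q + 1)) / K ^ (q
+ 1)`. Comparing with a higher power of the argument makes this at least `3 * φ(2 * K ^ q)`. -/
theorem eventually_phi_gap {y z : ℝ} (h : (y, z) ∈ Theta) {q : ℕ} (hq : 1 ≤ q) :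
    ∀ᶠ K : ℕ in atTop, ∀ m : ℕ, K ^ (q + 1) ≤ m →
      ⌊phi y z m⌋₊ + 3 * ⌊phi y z (2 * K ^ q : ℕ)⌋₊ ≤ ⌊phi y z (m + 1 : ℕ)⌋₊ := by
  obtain ⟨m₁, -, h1⟩ := exists_phi_mul_pow_le h 1
  -- The exponent is chosen so that `(K / 2) ^ (2 * (q + 2)) ≥ K ^ (q + 2) ≥ 3 * K ^ (q + 1)` once
  -- `K ≥ 4`.
  obtain ⟨m₂, -, h2⟩ := exists_phi_mul_pow_le h (2 * (q + 2))
  filter_upwards [eventually_ge_atTop m₁, eventually_ge_atTop m₂, eventually_ge_atTop 4]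
    with K hK1 hK2 hK4 m hm
  have hK0 : 0 < K := by omega
  have hKq : K ≤ K ^ q := Nat.le_self_pow (by omega) K
  have hKq' : 2 * K ^ q ≤ K ^ (q + 1) := by rw [pow_succ']; exact Nat.mul_le_mul_right _ (by omega)
  have hmR : ((K ^ (q + 1) : ℕ) : ℝ) ≤ m := by exact_mod_cast hm
  have ha : phi y z m * ((m + 1 : ℕ) : ℝ) ≤ phi y z (m + 1 : ℕ) * m := by
    simpa only [pow_one] using h1 m (m + 1) (by omega) (Nat.le_succ m)
  have hb : phi y z (K ^ (q + 1) : ℕ) * m ≤ phi y z m * (K ^ (q + 1) : ℕ) := by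
    simpa only [pow_one] using h1 (K ^ (q + 1)) m (by omega) hm
  have hc := h2 (2 * K ^ q) (K ^ (q + 1)) (by omega) hKq'
  have hKR : (4 : ℝ) ≤ K := by exact_mod_cast hK4
  have hsplit : (((K ^ (q + 1) : ℕ) : ℝ)) ^ (2 * (q + 2)) =
      ((2 * K ^ q : ℕ) : ℝ) ^ (2 * (q + 2)) * ((K : ℝ) / 2) ^ (2 * (q + 2)) := by
    rw [← mul_pow]; congr 1; push_cast; ring
  have hpos : (0 : ℝ) < ((2 * K ^ q : ℕ) : ℝ) ^ (2 * (q + 2)) := by positivity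
  have hd : phi y z (2 * K ^ q : ℕ) * ((K : ℝ) / 2) ^ (2 * (q + 2)) ≤
      phi y z (K ^ (q + 1) : ℕ) := by
    rw [hsplit] at hc
    refine le_of_mul_le_mul_right ?_ hpos
    linarith
  have he : 3 * ((K ^ (q + 1) : ℕ) : ℝ) ≤ ((K : ℝ) / 2) ^ (2 * (q + 2)) := by
    rw [pow_mul]
    calc 3 * ((K ^ (q + 1) : ℕ) : ℝ) ≤ K * (K : ℝ) ^ (q + 1) := by
          push_cast; exact mul_le_mul_of_nonneg_right (by linarith) (by positivity)
      _ = (K : ℝ) ^ (q + 2) := by ring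
      _ ≤ _ := pow_le_pow_left₀ (by positivity) (by nlinarith) _
  have hφ := phi_pos y z (2 * K ^ q : ℕ)
  have hf : 3 * phi y z (2 * K ^ q : ℕ) * (K ^ (q + 1) : ℕ) ≤ phi y z (K ^ (q + 1) : ℕ) := by
    nlinarith
  have hKp : (0 : ℝ) < (K ^ (q + 1) : ℕ) := by positivity
  have hm0 : (0 : ℝ) < m := hKp.trans_le hmR
  have hg : 3 * phi y z (2 * K ^ q : ℕ) * m ≤ phi y z m := by
    refine le_of_mul_le_mul_right ?_ hKp
    nlinarith
  have hfin : phi y z m + 3 * phi y z (2 * K ^ q : ℕ) ≤ phi y z (m + 1 : ℕ) := by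
    refine le_of_mul_le_mul_right ?_ hm0
    push_cast at ha hg ⊢
    linarith
  refine Nat.le_floor ?_
  push_cast at hfin ⊢
  have h3 := Nat.floor_le (phi_pos y z m).le
  have h4 := Nat.floor_le (phi_pos y z (2 * K ^ q : ℕ)).le
  push_cast at h4
  linarith

theorem eventually_pow_le_floor_phi {y z : ℝ} (h : (y, z) ∈ Theta) (r : ℕ) :
    ∀ᶠ m : ℕ in atTop, m ^ r ≤ ⌊phi y z m⌋₊ := by
  have h1 := (tendsto_rpow_mul_log_rpow h).eventually_ge_atTop (r : ℝ)
  filter_upwards [tendsto_log_natCast.eventually h1, tendsto_log_natCast.eventually_gt_atTop 0,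
    eventually_gt_atTop 0] with m hm hl hm0
  refine Nat.le_floor ?_
  have hm0' : (0 : ℝ) < m := by exact_mod_cast hm0
  push_cast
  rw [phi_eq_exp_logPhi, logPhi_eq hl]
  nth_rewrite 1 [← Real.exp_log hm0']
  rw [← Real.exp_nat_mul]
  exact Real.exp_le_exp.mpr (by nlinarith)

theorem eventually_logPhi_log_le {y z : ℝ} (hy : 0 ≤ y) (r : ℕ) (hr : 1 ≤ r) :
    ∃ C : ℝ, 1 ≤ C ∧ ∀ᶠ κ : ℕ in atTop, ∀ n : ℕ, κ ≤ n → n ≤ κ ^ r →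
      logPhi y z (Real.log n) ≤ C * logPhi y z (Real.log κ) := by
  obtain ⟨C, hC, h⟩ := exists_logPhi_le_mul (z := z) hy (c := r) (by exact_mod_cast hr)
  refine ⟨C, hC, ?_⟩
  filter_upwards [tendsto_log_natCast.eventually h, eventually_gt_atTop 0] with κ hκ h0 n h1 h2
  have h0' : (0 : ℝ) < κ := by exact_mod_cast h0
  have h1' : (κ : ℝ) ≤ n := by exact_mod_cast h1
  refine hκ _ (Real.log_le_log h0' h1') ?_
  rw [← Real.log_pow]
  exact Real.log_le_log (by linarith) (by exact_mod_cast h2)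

/-- Sparsity of `G` against `F`: passing from `κ` to `κ ^ r` multiplies `log φ₁` by a bounded
factor, whereas `log φ₂ / log φ₁` tends to infinity. -/
theorem eventually_floor_phi_lt {y₁ z₁ y₂ z₂ : ℝ} (h₁ : (y₁, z₁) ∈ Theta) (h₂ : (y₂, z₂) ∈ Theta)
    (h : (y₂ - y₁, z₂ - z₁) ∈ Theta) (r : ℕ) (hr : 1 ≤ r) :
    ∀ᶠ κ : ℕ in atTop, ∀ n m : ℕ, κ ≤ n → n ≤ κ ^ r → κ ≤ m →
      ⌊phi y₁ z₁ n⌋₊ < ⌊phi y₂ z₂ m⌋₊ := by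
  have hy₁ : 0 ≤ y₁ := by
    rcases h₁ with h | ⟨h, -⟩
    · exact le_of_lt h
    · exact le_of_eq (Eq.symm h)
  obtain ⟨C, hC, hC'⟩ := eventually_logPhi_log_le (z := z₁) hy₁ r hr
  obtain ⟨u₀, hu₀, hmono⟩ := exists_logPhi_add_le h₂ 0
  -- The extra `1` gives a factor `e` between the values of `φ`, enough to separate their floors.
  have hratio := (tendsto_rpow_mul_log_rpow h).eventually_ge_atTop (C + 1)
  have hbig := (tendsto_rpow_mul_log_rpow h₁).eventually_ge_atTop 1
  filter_upwards [hC', tendsto_log_natCast.eventually_ge_atTop u₀,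
    tendsto_log_natCast.eventually_gt_atTop 1,
    tendsto_log_natCast.eventually hratio, tendsto_log_natCast.eventually hbig,
    eventually_gt_atTop 0] with κ h3 h4 h5 h6 h7 h8 n m hn hn' hm
  set u := Real.log κ with hu
  have h8' : (0 : ℝ) < κ := by exact_mod_cast h8
  have hum : u ≤ Real.log m := Real.log_le_log h8' (by exact_mod_cast hm)
  have h9 := hmono u _ h4 hum
  have hu0 : 0 < u := by linarith
  have hl := Real.log_pos h5
  have h10 : logPhi y₂ z₂ u =
      logPhi y₁ z₁ u * (u ^ (y₂ - y₁) * Real.log u ^ (z₂ - z₁)) := by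
    rw [logPhi, logPhi, Real.rpow_sub hl, Real.rpow_sub hu0, Real.rpow_add hu0, Real.rpow_add hu0]
    have := Real.rpow_pos_of_pos hu0 y₁
    have := Real.rpow_pos_of_pos hl z₁
    field_simp
  have h11 : 1 ≤ logPhi y₁ z₁ u := by
    rw [logPhi_eq hu0]; nlinarith
  have h12 := h3 n hn hn'
  have h13 : logPhi y₁ z₁ (Real.log n) + 1 ≤ logPhi y₂ z₂ (Real.log m) := by
    nlinarith
  have h14 : phi y₁ z₁ n + 1 ≤ phi y₂ z₂ m := by
    have h15 : 0 ≤ logPhi y₁ z₁ (Real.log n) :=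
      logPhi_nonneg (h5.le.trans (Real.log_le_log h8' (by exact_mod_cast hn)))
    rw [phi_eq_exp_logPhi, phi_eq_exp_logPhi]
    refine le_trans ?_ (Real.exp_le_exp.mpr h13)
    rw [Real.exp_add]
    nlinarith [Real.add_one_le_exp (1 : ℝ), Real.one_le_exp h15]
  refine Nat.lt_of_succ_le (Nat.le_floor ?_)
  push_cast
  linarith [Nat.floor_le (phi_pos y₁ z₁ n).le]

/-- On this range `log φ` is at most a constant times `logPhi y z (log κ)`, which is `o(κ)`. A gap
of length `κ` therefore beats every polynomial in the positions considered. -/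
theorem eventually_mul_floor_phi_pow_lt {y z β : ℝ} (h : (y, z) ∈ Theta) (hβ : 1 < β) (r : ℕ)
    (hr : 1 ≤ r) (C₀ : ℝ) (k : ℕ) :
    ∀ᶠ κ : ℕ in atTop, ∀ n : ℕ, κ ≤ n → n ≤ κ ^ r →
      C₀ * ((⌊phi y z n⌋₊ : ℝ) + 1) ^ k < β ^ κ := by
  have hy : 0 ≤ y := by
    rcases h with h | ⟨h, -⟩
    · exact le_of_lt h
    · exact le_of_eq (Eq.symm h)
  obtain ⟨C, hC, hC'⟩ := eventually_logPhi_log_le (z := z) hy r hr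
  have hlβ := Real.log_pos hβ
  have hlit : ∀ᶠ u in atTop, |C₀| + k + k * C * logPhi y z u < Real.log β * Real.exp u := by
    have h1 : (fun u => |C₀| + k + k * C * logPhi y z u) =o[atTop] Real.exp := by
      refine ((Asymptotics.isLittleO_const_left.mpr (Or.inr ?_))).add
        ((logPhi_isLittleO_exp y z).const_mul_left _)
      exact tendsto_norm_atTop_atTop.comp Real.tendsto_exp_atTop
    filter_upwards [h1.def (half_pos hlβ)] with u hu
    rw [Real.norm_eq_abs, Real.norm_eq_abs, Real.abs_exp] at hu
    have := Real.exp_pos u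
    nlinarith [le_abs_self (|C₀| + k + k * C * logPhi y z u)]
  filter_upwards [hC', tendsto_log_natCast.eventually hlit,
    tendsto_log_natCast.eventually_gt_atTop 1, eventually_gt_atTop 0] with κ h1 h2 h3 h4 n hn hn'
  have h4' : (0 : ℝ) < κ := by exact_mod_cast h4
  have h5 := h1 n hn hn'
  have h6 : 0 ≤ logPhi y z (Real.log n) :=
    logPhi_nonneg (h3.le.trans (Real.log_le_log h4' (by exact_mod_cast hn)))
  rw [Real.exp_log h4'] at h2
  have h7 : (⌊phi y z n⌋₊ : ℝ) + 1 ≤ Real.exp (1 + logPhi y z (Real.log n)) := by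
    have := Nat.floor_le (phi_pos y z n).le
    rw [phi_eq_exp_logPhi] at this ⊢
    rw [Real.exp_add]
    nlinarith [Real.add_one_le_exp (1 : ℝ), Real.one_le_exp h6]
  have h8 : C₀ ≤ Real.exp |C₀| := by linarith [le_abs_self C₀, Real.add_one_le_exp |C₀|]
  have h9 : β ^ κ = Real.exp (Real.log β * κ) := by
    rw [mul_comm, Real.exp_nat_mul, Real.exp_log (by linarith)]
  rw [h9]
  calc _ ≤ Real.exp |C₀| * Real.exp (1 + logPhi y z (Real.log n)) ^ k :=
        mul_le_mul h8 (pow_le_pow_left₀ (by positivity) h7 _) (by positivity) (by positivity)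
    _ = Real.exp (|C₀| + k * (1 + logPhi y z (Real.log n))) := by
        rw [← Real.exp_nat_mul, ← Real.exp_add]
    _ < _ := by
        refine Real.exp_lt_exp.mpr (lt_of_le_of_lt ?_ h2)
        have : (0 : ℝ) ≤ k := Nat.cast_nonneg k
        nlinarith

/-- Consecutive values satisfy `φ(m + 1) ≤ φ(m) ^ p`, so the first value to reach `x` does not
overshoot `x ^ p`. This supplies the shift `t`. -/
theorem exists_floor_phi_mem_Icc_pow {y z : ℝ} (h : (y, z) ∈ Theta) :
    ∃ C : ℕ, ∀ᶠ x : ℕ in atTop, ∃ m : ℕ, 3 ≤ m ∧ x ≤ ⌊phi y z m⌋₊ ∧ ⌊phi y z m⌋₊ ≤ x ^ C := by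
  have hy : 0 ≤ y := by
    rcases h with h | ⟨h, -⟩
    · exact le_of_lt h
    · exact le_of_eq (Eq.symm h)
  obtain ⟨C, hC, hC'⟩ := exists_logPhi_le_mul (z := z) hy (c := 2) one_le_two
  obtain ⟨p, hp⟩ := exists_nat_ge C
  obtain ⟨m₀, hm₀⟩ := eventually_atTop.mp ((tendsto_log_natCast.eventually hC').and
    ((tendsto_log_natCast.eventually_gt_atTop 1).and (eventually_ge_atTop 3)))
  refine ⟨p, ?_⟩
  filter_upwards [eventually_gt_atTop ⌊phi y z m₀⌋₊] with x hx
  have hex : ∃ i, x ≤ ⌊phi y z (m₀ + i : ℕ)⌋₊ := by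
    obtain ⟨N, hN⟩ := eventually_atTop.mp (eventually_pow_le_floor_phi h 1)
    refine ⟨max N x, ?_⟩
    refine le_trans ?_ (hN (m₀ + max N x) (by omega))
    rw [pow_one]; omega
  classical
  have hspec := Nat.find_spec hex
  rcases hi : Nat.find hex with _ | i
  · rw [hi] at hspec
    exact absurd hspec (not_le.mpr hx)
  have hlt : ⌊phi y z (m₀ + i : ℕ)⌋₊ < x := by
    have := Nat.find_min hex (m := i) (by omega)
    omega
  rw [hi] at hspec
  obtain ⟨h1, h2, h3⟩ := hm₀ (m₀ + i) (Nat.le_add_right _ _)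
  set m := m₀ + i with hm
  refine ⟨m + 1, by omega, hspec, ?_⟩
  have hm3 : (3 : ℝ) ≤ m := by exact_mod_cast h3
  have h4 : Real.log (m + 1 : ℕ) ≤ 2 * Real.log m := by
    rw [two_mul, ← Real.log_mul (by linarith) (by linarith)]
    refine Real.log_le_log (by positivity) ?_
    push_cast; nlinarith
  have h5 := h1 _ (Real.log_le_log (by linarith) (by push_cast; linarith)) h4
  have h6 := logPhi_nonneg (y := y) (z := z) h2.le
  have h7 : phi y z (m + 1 : ℕ) ≤ phi y z m ^ p := by
    rw [phi_eq_exp_logPhi, phi_eq_exp_logPhi, ← Real.exp_nat_mul]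
    exact Real.exp_le_exp.mpr (h5.trans (mul_le_mul_of_nonneg_right hp h6))
  refine Nat.floor_le_of_le (h7.trans ?_)
  push_cast
  exact pow_le_pow_left₀ (phi_pos _ _ _).le ((Nat.floor_lt (phi_pos _ _ _).le).mp hlt).le _

end BetaSeries

end

/-! ### Choice of parameters and the contradiction -/

section

open Filter Topology

namespace PowerSeries

theorem exists_partialSum_ofExponents_le {a : ℕ → ℕ} (ha : ∀ᶠ k in atTop, k ≤ a k) :
    ∃ C : ℕ, ∀ n, partialSum (ofExponents a) n ≤ C * (n + 1) := by
  obtain ⟨k₀, hk₀⟩ := eventually_atTop.mp ha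
  refine ⟨k₀ + 2, fun n => (partialSum_ofExponents_le (p := k₀ + n + 1) fun k hk => ?_).trans ?_⟩
  · have := hk₀ k (by omega); omega
  · nlinarith

theorem summable_pow_of_eventually_le {a : ℕ → ℕ} (ha : ∀ᶠ k in atTop, k ≤ a k) {x : ℝ}
    (hx0 : 0 ≤ x) (hx1 : x < 1) : Summable fun k => x ^ a k := by
  refine Summable.of_norm_bounded_eventually_nat (summable_geometric_of_lt_one hx0 hx1) ?_
  filter_upwards [ha] with k hk
  rw [Real.norm_of_nonneg (pow_nonneg hx0 _)]
  exact pow_le_pow_of_le_one hx0 hx1.le hk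

end PowerSeries

namespace BetaSeries
open PowerSeries

theorem sum_coeff_mul_eq {ι : Type*} {S : Finset ι} {α : ι → ℤ} {f g : ι → ℕ}
    {F G : PowerSeries ℕ} (hF : 0 < coeff 0 F) (hG : 0 < coeff 0 G) {i₀ : ι} (hi₀ : i₀ ∈ S)
    {D b B : ℕ} (hf₀ : f i₀ = D + 1) (hg₀ : g i₀ = b)
    (hS : ∀ i ∈ S, i ≠ i₀ → (f i ≤ D ∧ g i ≤ B) ∨ (f i = D + 1 ∧ g i < b)) {n : ℕ}
    (h1 : coeff n (F ^ D * G ^ B) = 0) (h2 : ∀ j < b, coeff n (F ^ (D + 1) * G ^ j) = 0) :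
    ∑ i ∈ S, α i * ((coeff n (F ^ f i * G ^ g i) : ℕ) : ℤ) =
      α i₀ * ((coeff n (F ^ (D + 1) * G ^ b) : ℕ) : ℤ) := by
  rw [Finset.sum_eq_single_of_mem i₀ hi₀ fun i hi hne => ?_, hf₀, hg₀]
  have : coeff n (F ^ f i * G ^ g i) = 0 := by
    rcases hS i hi hne with ⟨h3, h4⟩ | ⟨h3, h4⟩
    · exact Nat.le_zero.mp (h1 ▸ coeff_pow_mul_pow_mono hF hG h3 h4 n)
    · rw [h3]; exact h2 _ h4
  rw [this]; simp

theorem two_mul_add_le_pow {κ a p t : ℕ} (hκ : 4 ≤ κ) (ht : t ≤ ((κ ^ a + 2) * κ) ^ p) :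
    2 * ((κ ^ a + 1) * (t + κ)) ≤ κ ^ (a + 1 + ((a + 2) * p + 2)) := by
  have ha : 0 < κ ^ a := by positivity
  have h1 : t ≤ κ ^ ((a + 2) * p) := by
    refine ht.trans ?_
    rw [pow_mul]
    refine Nat.pow_le_pow_left ?_ _
    calc (κ ^ a + 2) * κ ≤ (κ ^ a * κ) * κ := Nat.mul_le_mul_right _ (by nlinarith)
      _ = κ ^ (a + 2) := by ring
  have h2 : 0 < κ ^ ((a + 2) * p) := by positivity
  have h3 : t + κ ≤ κ ^ ((a + 2) * p + 2) := by
    rw [pow_add]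
    have h5 := Nat.mul_le_mul_left (κ ^ ((a + 2) * p)) (show κ + 1 ≤ κ ^ 2 by nlinarith)
    have h6 := Nat.mul_le_mul_right κ h2
    rw [Nat.mul_add] at h5
    omega
  have h4 : 2 * (κ ^ a + 1) ≤ κ ^ (a + 1) := by
    rw [pow_succ]; nlinarith
  rw [← mul_assoc, pow_add κ (a + 1)]
  exact Nat.mul_le_mul h4 h3

theorem eventually_le_floor_phi {y z : ℝ} (h : (y, z) ∈ Theta) :
    ∀ᶠ k : ℕ in atTop, k ≤ ⌊phi y z (k + 3 : ℕ)⌋₊ := by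
  filter_upwards [(tendsto_add_atTop_nat 3).eventually (eventually_pow_le_floor_phi h 1)]
    with k hk
  rw [pow_one] at hk
  exact (Nat.le_add_right k 3).trans hk

theorem exists_isolated_of_phi {y₁ z₁ y₂ z₂ : ℝ} (h₁ : (y₁, z₁) ∈ Theta)
    (h₂ : (y₂, z₂) ∈ Theta) (h : (y₂ - y₁, z₂ - z₁) ∈ Theta) {β : ℝ} (hβ : 1 < β)
    {D b B : ℕ} (hbB : b ≤ B) (C₀ : ℝ) (k₀ : ℕ) {F G : PowerSeries ℕ}
    (hF : F = ofExponents fun k => ⌊phi y₁ z₁ (k + 3 : ℕ)⌋₊)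
    (hG : G = ofExponents fun k => ⌊phi y₂ z₂ (k + 3 : ℕ)⌋₊) :
    ∃ v l : ℕ, l ≤ v ∧ 0 < l ∧ C₀ * ((v : ℝ) + l + 1) ^ k₀ < β ^ l ∧
      0 < coeff v (F ^ (D + 1) * G ^ b) ∧
      (∀ n, v < n + l → n < v + l → coeff n (F ^ D * G ^ B) = 0) ∧
      (∀ n, v < n + l → n < v + l → ∀ i < b, coeff n (F ^ (D + 1) * G ^ i) = 0) ∧
      (∀ n, v < n + l → n < v → coeff n (F ^ (D + 1) * G ^ b) = 0) := by
  set A₁ : ℕ → ℕ := fun m => ⌊phi y₁ z₁ m⌋₊ with hA₁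
  set A₂ : ℕ → ℕ := fun m => ⌊phi y₂ z₂ m⌋₊ with hA₂
  set a₁ : ℕ → ℕ := fun k => A₁ (k + 3) with ha₁
  set a₂ : ℕ → ℕ := fun k => A₂ (k + 3) with ha₂
  have ht₁ : Tendsto a₁ atTop atTop := tendsto_atTop_mono' _ (eventually_le_floor_phi h₁) tendsto_id
  have ht₂ : Tendsto a₂ atTop atTop := tendsto_atTop_mono' _ (eventually_le_floor_phi h₂) tendsto_id
  have hF0 : 0 < coeff 0 F := hF ▸ coeff_zero_ofExponents_pos _
  have hG0 : 0 < coeff 0 G := hG ▸ coeff_zero_ofExponents_pos _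
  have hFpos : ∀ m, 3 ≤ m → 0 < coeff (A₁ m) F := fun m hm => by
    have := coeff_ofExponents_pos ht₁ (m - 3)
    simp only [ha₁, Nat.sub_add_cancel hm] at this
    exact hF ▸ this
  have hGpos : ∀ m, 3 ≤ m → 0 < coeff (A₂ m) G := fun m hm => by
    have := coeff_ofExponents_pos ht₂ (m - 3)
    simp only [ha₂, Nat.sub_add_cancel hm] at this
    exact hG ▸ this
  obtain ⟨p, hp⟩ := exists_floor_phi_mem_Icc_pow h₂
  -- This gives `(E + 1) * D + 1 = e * (D + 1)`, so the mass of `F ^ D * G ^ B`, below `K ^ ((E + 1)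
  -- * D + 1)`, is less than `#V ≥ K ^ ((e + 1) * (D + 1))`.
  set e := (D + 1) ^ 2 with he
  set E := e + (D + 1) with hE
  -- With `K = κ ^ (B + 1)`, `κ ^ rM` bounds the mass of `F ^ (D + 1) * G ^ B`, and `κ ^ r` bounds
  -- the cutoff index `n₀ = K ^ (E + 1) + 1`.
  set rM := (B + 1) * ((E + 1) * (D + 1) + 1) with hrM
  set r := (B + 1) * (E + 1) + 1 with hr
  have hK : Tendsto (fun κ : ℕ => κ ^ (B + 1)) atTop atTop := tendsto_pow_atTop (by omega)
  have hx : Tendsto (fun κ : ℕ => (κ ^ rM + 2) * κ) atTop atTop :=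
    tendsto_atTop_mono (fun κ => Nat.le_mul_of_pos_left κ (by omega)) tendsto_id
  have hgap : ∀ᶠ κ : ℕ in atTop, ∀ j ∈ Finset.range (D + 2), ∀ m,
      (κ ^ (B + 1)) ^ (e + j + 1) ≤ m →
        A₁ m + 3 * A₁ (2 * (κ ^ (B + 1)) ^ (e + j)) ≤ A₁ (m + 1) := by
    refine (Finset.eventually_all _).mpr fun j _ => ?_
    exact hK.eventually (eventually_phi_gap h₁ (q := e + j)
      (by have : 0 < e := by positivity
          omega))
  obtain ⟨m₁, hm₁⟩ := eventually_atTop.mp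
    (eventually_pow_le_floor_phi h₁ (rM + 1 + ((rM + 2) * p + 2)))
  have hr1 : 1 ≤ r := by omega
  obtain ⟨κ, hgap, hlt, hexp, hκt, hκ4, hκm⟩ := (hgap.and
    ((eventually_floor_phi_lt h₁ h₂ h r hr1).and
    ((eventually_mul_floor_phi_pow_lt h₁ hβ r hr1 |C₀| k₀).and ((hx.eventually hp).and
    ((eventually_ge_atTop 4).and (eventually_ge_atTop m₁)))))).exists
  obtain ⟨mt, hmt3, hxt, htx⟩ := hκt
  set t := A₂ mt with ht
  set K := κ ^ (B + 1) with hKdef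
  have hκK : κ ≤ K := Nat.le_self_pow (by omega) κ
  have hK0 : 0 < K := by omega
  set M := κ ^ rM with hM
  have hM0 : 0 < M := by positivity
  set L := (M + 1) * (t + κ) with hL
  set n₀ := K ^ (E + 1) + 1 with hn₀
  have hKE : K ≤ K ^ (E + 1) := Nat.le_self_pow (by omega) K
  have hn₀κ : κ ≤ n₀ := by omega
  have hn₀r : n₀ ≤ κ ^ r := by
    rw [hn₀, hr, pow_succ κ, pow_mul, ← hKdef]
    have h3 := Nat.mul_le_mul_left (K ^ (E + 1)) (show 2 ≤ κ by omega)
    omega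
  have hgapE := hgap (D + 1) (by simp)
  rw [← hE] at hgapE
  have hmono : ∀ m, n₀ ≤ m → A₁ n₀ ≤ A₁ m := by
    intro m hm
    induction m, hm using Nat.le_induction with
    | base => exact le_rfl
    | succ m hm ih =>
      have := hgapE m (by omega)
      omega
  have hLpos : 0 < L := by positivity
  -- `L` is bounded by a power of `κ` with exponent independent of `κ`, and `φ₁` outgrows every
  -- power.
  have h2L : 2 * L ≤ A₁ (2 * K ^ e) := by
    have hKe : K ≤ K ^ e := Nat.le_self_pow (by positivity) K
    calc 2 * L ≤ κ ^ (rM + 1 + ((rM + 2) * p + 2)) := two_mul_add_le_pow hκ4 htx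
      _ ≤ (2 * K ^ e) ^ (rM + 1 + ((rM + 2) * p + 2)) := Nat.pow_le_pow_left (by omega) _
      _ ≤ _ := hm₁ _ (by omega)
  obtain ⟨V, hV1, hV2, hV3, hV4, hV5⟩ := exists_isSpaced_coeff_pow_pos (F := F) (A := A₁) (K := K)
    (e := e) (s := 2 * L) (D := D + 1) (by omega) (fun m hm => hFpos m (by
        have : K ≤ K ^ (e + 1) := Nat.le_self_pow (by omega) K
        omega))
    (fun j hj => hgap j (Finset.mem_range.mpr (by omega))) hK0 h2L (D + 1) le_rfl
  rw [← hE] at hV3 hV5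
  have hA0 := hgapE (K ^ (E + 1)) le_rfl
  rw [← hn₀] at hA0
  -- Stopping just before `A₁ n₀` leaves at most `K ^ (E + 1)` terms of `F` and, as `A₂` already
  -- exceeds `A₁ n₀` from `κ` on, at most `κ` terms of `G`.
  obtain ⟨N, hN⟩ : ∃ N, A₁ n₀ = N + 1 := Nat.exists_eq_add_of_lt (by omega : 0 < A₁ n₀) |>.imp
    fun N hN => by omega
  have hpF : partialSum F N ≤ K ^ (E + 1) := by
    rw [hF]
    refine (partialSum_ofExponents_le (p := K ^ (E + 1) - 1) fun k hk => ?_).trans (by omega)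
    have := hmono (k + 3) (by omega)
    exact lt_of_lt_of_le (by omega) this
  have hpG : partialSum G N ≤ κ := by
    rw [hG]
    refine (partialSum_ofExponents_le (p := κ - 1) fun k hk => ?_).trans (by omega)
    have : A₁ n₀ < A₂ (k + 3) := hlt n₀ (k + 3) hn₀κ hn₀r (by omega)
    exact lt_trans (by omega) this
  have hκB : κ ^ B < K := Nat.pow_lt_pow_right (by omega) (by omega)
  obtain ⟨v, hv1, hv2, hv3, hv4, hv5, hv6⟩ := exists_isolated (F := F) (G := G) hF0 hG0
    (D := D) (B := B) (b := b) (N := N) (L := L) (M := M) (l := κ) (t := t) (V := V) hbB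
    (by omega) hV1 hV2 (fun v hv => by have := hV3 v hv; omega)
    (by
      refine lt_of_lt_of_le ?_ hV4
      refine (partialSum_pow_mul_pow_le F G N D B).trans_lt ?_
      calc _ ≤ (K ^ (E + 1)) ^ D * κ ^ B :=
            Nat.mul_le_mul (Nat.pow_le_pow_left hpF _) (Nat.pow_le_pow_left hpG _)
        _ < (K ^ (E + 1)) ^ D * K := Nat.mul_lt_mul_of_pos_left hκB (by positivity)
        _ = K ^ ((E + 1) * D + 1) := by rw [pow_add K ((E + 1) * D) 1, pow_mul, pow_one]
        _ ≤ _ := Nat.pow_le_pow_right hK0 (by rw [hE, he]; nlinarith))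
    (by
      refine (partialSum_pow_mul_pow_le F G N (D + 1) B).trans ?_
      calc _ ≤ (K ^ (E + 1)) ^ (D + 1) * κ ^ B :=
            Nat.mul_le_mul (Nat.pow_le_pow_left hpF _) (Nat.pow_le_pow_left hpG _)
        _ ≤ (K ^ (E + 1)) ^ (D + 1) * K := Nat.mul_le_mul_left _ hκB.le
        _ = M := by
            rw [hM, hrM, pow_mul κ, ← hKdef, pow_add K ((E + 1) * (D + 1)) 1, pow_mul, pow_one])
    (hGpos mt hmt3) hxt le_rfl
  refine ⟨v, κ, hv1, by omega, lt_of_le_of_lt ?_ (hexp n₀ hn₀κ hn₀r), hv3, hv4, hv5, hv6⟩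
  refine mul_le_mul (le_abs_self _) (pow_le_pow_left₀ (by positivity) ?_ _) (by positivity)
    (abs_nonneg _)
  have : v + κ + 1 ≤ A₁ n₀ + 1 := by omega
  exact_mod_cast this

theorem sum_mul_xi_pow_ne_zero {y₁ z₁ y₂ z₂ : ℝ} (h₁ : (y₁, z₁) ∈ Theta) (h₂ : (y₂, z₂) ∈ Theta)
    (h : (y₂ - y₁, z₂ - z₁) ∈ Theta) {β : ℝ} (hβ : 1 < β) (hint : IsIntegral ℤ β)
    (hconj : ∀ γ : ℂ, IsConjRoot ℚ (β : ℂ) γ → γ ≠ (β : ℂ) → ‖γ‖ ≤ 1)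
    {ι : Type*} {S : Finset ι} {α : ι → ℤ} {f g : ι → ℕ} {i₀ : ι} (hi₀ : i₀ ∈ S)
    (hα : 0 < α i₀) {D b B : ℕ} (hf₀ : f i₀ = D + 1) (hg₀ : g i₀ = b) (hbB : b ≤ B)
    (hS : ∀ i ∈ S, i ≠ i₀ → (f i ≤ D ∧ g i ≤ B) ∨ (f i = D + 1 ∧ g i < b)) :
    ∑ i ∈ S, (α i : ℝ) * (xi y₁ z₁ β⁻¹ ^ f i * xi y₂ z₂ β⁻¹ ^ g i) ≠ 0 := by
  intro hzero
  have hx0 : 0 ≤ β⁻¹ := by positivity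
  have hx1 : β⁻¹ < 1 := inv_lt_one_of_one_lt₀ hβ
  set a₁ : ℕ → ℕ := fun k => ⌊phi y₁ z₁ (k + 3 : ℕ)⌋₊ with ha₁
  set a₂ : ℕ → ℕ := fun k => ⌊phi y₂ z₂ (k + 3 : ℕ)⌋₊ with ha₂
  have hle₁ : ∀ᶠ k in atTop, k ≤ a₁ k := eventually_le_floor_phi h₁
  have hle₂ : ∀ᶠ k in atTop, k ≤ a₂ k := eventually_le_floor_phi h₂
  set F := ofExponents a₁ with hF
  set G := ofExponents a₂ with hG
  have hF0 : 0 < coeff 0 F := coeff_zero_ofExponents_pos _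
  have hG0 : 0 < coeff 0 G := coeff_zero_ofExponents_pos _
  have hsF : HasSum (fun n => ((coeff n F : ℕ) : ℝ) * β⁻¹ ^ n) (xi y₁ z₁ β⁻¹) :=
    hasSum_ofExponents (summable_pow_of_eventually_le hle₁ hx0 hx1)
  have hsG : HasSum (fun n => ((coeff n G : ℕ) : ℝ) * β⁻¹ ^ n) (xi y₂ z₂ β⁻¹) :=
    hasSum_ofExponents (summable_pow_of_eventually_le hle₂ hx0 hx1)
  set c : ℕ → ℤ := fun n => ∑ i ∈ S, α i * ((coeff n (F ^ f i * G ^ g i) : ℕ) : ℤ) with hc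
  have hcsum : HasSum (fun n => (c n : ℝ) * β⁻¹ ^ n) 0 := by
    rw [← hzero]
    have := hasSum_sum (s := S) fun i _ => (hasSum_mul hx0 (hasSum_pow hx0 hsF (f i))
      (hasSum_pow hx0 hsG (g i))).mul_left (α i : ℝ)
    have he : (fun n => (c n : ℝ) * β⁻¹ ^ n) = fun n =>
        ∑ i ∈ S, (α i : ℝ) * (((coeff n (F ^ f i * G ^ g i) : ℕ) : ℝ) * β⁻¹ ^ n) := by
      funext n
      simp only [hc]
      push_cast
      rw [Finset.sum_mul]
      exact Finset.sum_congr rfl fun i _ => mul_assoc _ _ _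
    rw [he]
    exact this
  obtain ⟨CF, hCF⟩ := exists_partialSum_ofExponents_le hle₁
  obtain ⟨CG, hCG⟩ := exists_partialSum_ofExponents_le hle₂
  have hcb : ∀ n, |(c n : ℝ)| ≤
      ((∑ i ∈ S, |α i| : ℤ) : ℝ) * (CF ^ (D + 1) * CG ^ B) * ((n : ℝ) + 1) ^ (D + 1 + B) := by
    intro n
    have hi : ∀ i ∈ S, |α i * ((coeff n (F ^ f i * G ^ g i) : ℕ) : ℤ)| ≤
        |α i| * (CF ^ (D + 1) * CG ^ B * ((n : ℤ) + 1) ^ (D + 1 + B)) := by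
      intro i hi
      rw [abs_mul, Nat.abs_cast]
      refine mul_le_mul_of_nonneg_left ?_ (abs_nonneg _)
      have hfi : f i ≤ D + 1 ∧ g i ≤ B := by
        by_cases hne : i = i₀
        · subst hne; omega
        · have := hS i hi hne; omega
      have := (coeff_pow_mul_pow_mono hF0 hG0 hfi.1 hfi.2 n).trans
        ((coeff_le_partialSum _ n).trans ((partialSum_pow_mul_pow_le F G n _ _).trans
          (Nat.mul_le_mul (Nat.pow_le_pow_left (hCF n) _) (Nat.pow_le_pow_left (hCG n) _))))
      have h2 : (CF * (n + 1)) ^ (D + 1) * (CG * (n + 1)) ^ B =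
          CF ^ (D + 1) * CG ^ B * (n + 1) ^ (D + 1 + B) := by
        rw [mul_pow, mul_pow, pow_add]; ring
      rw [h2] at this
      exact_mod_cast this
    have := (Finset.abs_sum_le_sum_abs _ _).trans (Finset.sum_le_sum hi)
    rw [← Finset.sum_mul] at this
    rw [mul_assoc]
    exact_mod_cast this
  obtain ⟨d, hd⟩ := exists_one_le_abs_sum_mul_pow hint hconj
  obtain ⟨C₀, k₀, hiso⟩ := exists_pow_le_of_isolated hβ hd hcb hcsum
  obtain ⟨v, κ, hv1, hκ0, hexp, hv3, hv4, hv5, hv6⟩ :=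
    exists_isolated_of_phi h₁ h₂ h hβ (D := D) hbB C₀ k₀ hF hG
  have hcn : ∀ n, v < n + κ → n < v + κ →
      c n = α i₀ * ((coeff n (F ^ (D + 1) * G ^ b) : ℕ) : ℤ) := fun n hn1 hn2 =>
    sum_coeff_mul_eq hF0 hG0 hi₀ hf₀ hg₀ hS (hv4 n hn1 hn2) (hv5 n hn1 hn2)
  have hfin := hiso v κ hv1 (by
      rw [hcn v (by omega) (by omega)]
      exact mul_pos hα (by exact_mod_cast hv3))
    (fun n hn1 hn2 => by rw [hcn n hn1 (by omega), hv6 n hn1 hn2]; simp)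
    (fun n hn1 hn2 => by
      rw [hcn n (by omega) hn2]
      exact mul_nonneg hα.le (Nat.cast_nonneg _))
  exact absurd hexp (not_lt.mpr hfin)

theorem algebraicIndependent_xi_of_sub_mem {y₁ z₁ y₂ z₂ : ℝ} (h₁ : (y₁, z₁) ∈ Theta)
    (h₂ : (y₂, z₂) ∈ Theta) (h : (y₂ - y₁, z₂ - z₁) ∈ Theta) {β : ℝ} (hβ : 1 < β)
    (hint : IsIntegral ℤ β)
    (hconj : ∀ γ : ℂ, IsConjRoot ℚ (β : ℂ) γ → γ ≠ (β : ℂ) → ‖γ‖ ≤ 1) :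
    AlgebraicIndependent ℚ ![xi y₁ z₁ β⁻¹, xi y₂ z₂ β⁻¹] := by
  rw [algebraicIndependent_iff]
  intro P hP
  by_contra hP0
  obtain ⟨q, hq⟩ := IsLocalization.exist_integer_multiples_of_finset (nonZeroDivisors ℤ)
    (P.support.image P.coeff)
  have hq0 : (q : ℤ) ≠ 0 := nonZeroDivisors.coe_ne_zero q
  have hq' : ∀ i ∈ P.support, ∃ k : ℤ, (k : ℚ) = (q : ℤ) * P.coeff i := by
    intro i hi
    obtain ⟨k, hk⟩ := hq _ (Finset.mem_image_of_mem _ hi)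
    exact ⟨k, by simpa [zsmul_eq_mul] using hk⟩
  choose! α hα using hq'
  -- The exponent of the denser series `F` is compared first.
  obtain ⟨i₀, hi₀, hmax⟩ := Finset.exists_max_image P.support
    (fun i => toLex (i 0, i 1)) (MvPolynomial.support_nonempty.mpr hP0)
  have hα0 : α i₀ ≠ 0 := by
    intro h0
    have := hα i₀ hi₀
    rw [h0, Int.cast_zero, eq_comm, mul_eq_zero] at this
    rcases this with h | h
    · exact hq0 (by exact_mod_cast h)
    · exact MvPolynomial.mem_support_iff.mp hi₀ h
  have hlow : ∀ i ∈ P.support, i ≠ i₀ →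
      (i 0 + 1 ≤ i₀ 0 ∧ i 1 ≤ P.support.sup fun i => i 1) ∨
        (i 0 + 1 = i₀ 0 + 1 ∧ i 1 < i₀ 1) := by
    intro i hi hne
    have h3 := hmax i hi
    rw [Prod.Lex.toLex_le_toLex] at h3
    rcases h3 with h3 | ⟨h3, h4⟩
    · exact Or.inl ⟨h3, Finset.le_sup (f := fun i : Fin 2 →₀ ℕ => i 1) hi⟩
    · refine Or.inr ⟨congrArg (· + 1) h3, lt_of_le_of_ne h4 fun h5 => hne ?_⟩
      ext j
      fin_cases j
      · exact h3
      · exact h5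
  -- The extra factor `ξ₁` makes the leading `F`-exponent positive, even when `P` does not involve
  -- `ξ₁`.
  have hsum : ∑ i ∈ P.support, (α i : ℝ) *
      (xi y₁ z₁ β⁻¹ ^ (i 0 + 1) * xi y₂ z₂ β⁻¹ ^ i 1) = 0 := by
    rw [MvPolynomial.aeval_def, MvPolynomial.eval₂_eq'] at hP
    have h3 : ∀ i ∈ P.support, (α i : ℝ) *
        (xi y₁ z₁ β⁻¹ ^ (i 0 + 1) * xi y₂ z₂ β⁻¹ ^ i 1) = ((q : ℤ) : ℝ) * xi y₁ z₁ β⁻¹ *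
          (algebraMap ℚ ℝ (P.coeff i) * ∏ j, ![xi y₁ z₁ β⁻¹, xi y₂ z₂ β⁻¹] j ^ i j) := by
      intro i hi
      have h4 : (α i : ℝ) = ((q : ℤ) : ℝ) * ((P.coeff i : ℚ) : ℝ) := by exact_mod_cast hα i hi
      rw [h4, Fin.prod_univ_two, eq_ratCast]
      simp only [Matrix.cons_val_zero, Matrix.cons_val_one]
      ring
    rw [Finset.sum_congr rfl h3, ← Finset.mul_sum, hP, mul_zero]
  have hB : i₀ 1 ≤ P.support.sup fun i => i 1 :=
    Finset.le_sup (f := fun i : Fin 2 →₀ ℕ => i 1) hi₀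
  rcases lt_or_gt_of_ne hα0 with hneg | hpos
  · refine sum_mul_xi_pow_ne_zero h₁ h₂ h hβ hint hconj (α := fun i => -α i)
      (f := fun i : Fin 2 →₀ ℕ => i 0 + 1) (g := fun i => i 1) hi₀ (by simpa using hneg) rfl rfl
      hB hlow ?_
    have h3 := congrArg Neg.neg hsum
    rw [← Finset.sum_neg_distrib, neg_zero] at h3
    rw [← h3]
    exact Finset.sum_congr rfl fun i _ => by push_cast; ring
  · exact sum_mul_xi_pow_ne_zero h₁ h₂ h hβ hint hconj
      (f := fun i : Fin 2 →₀ ℕ => i 0 + 1) (g := fun i => i 1) hi₀ hpos rfl rfl hB hlow hsum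

theorem sub_mem_Theta_or {y₁ z₁ y₂ z₂ : ℝ} (hne : (y₁, z₁) ≠ (y₂, z₂)) :
    (y₂ - y₁, z₂ - z₁) ∈ Theta ∨ (y₁ - y₂, z₁ - z₂) ∈ Theta := by
  rcases lt_trichotomy y₁ y₂ with h | rfl | h
  · exact Or.inl (Or.inl (sub_pos.mpr h))
  · rcases lt_trichotomy z₁ z₂ with h | rfl | h
    · exact Or.inl (Or.inr ⟨sub_self _, sub_pos.mpr h⟩)
    · exact absurd rfl hne
    · exact Or.inr (Or.inr ⟨sub_self _, sub_pos.mpr h⟩)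
  · exact Or.inr (Or.inl (sub_pos.mpr h))

end BetaSeries

end

theorem mainTheorem1 (y₁ z₁ y₂ z₂ : ℝ)
    (h₁ : (y₁, z₁) ∈ BetaSeries.Theta) (h₂ : (y₂, z₂) ∈ BetaSeries.Theta)
    (hne : (y₁, z₁) ≠ (y₂, z₂))
    (β : ℝ) (hβ : BetaSeries.IsPisot β ∨ BetaSeries.IsSalem β) :
    AlgebraicIndependent ℚ ![BetaSeries.xi y₁ z₁ β⁻¹, BetaSeries.xi y₂ z₂ β⁻¹] := by
  obtain ⟨h1, hint, hconj⟩ : 1 < β ∧ IsIntegral ℤ β ∧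
      ∀ γ : ℂ, IsConjRoot ℚ (β : ℂ) γ → γ ≠ (β : ℂ) → ‖γ‖ ≤ 1 := by
    rcases hβ with ⟨h1, h2, h3⟩ | ⟨h1, h2, h3, -⟩
    · exact ⟨h1, h2, fun γ hγ hne => (h3 γ hγ hne).le⟩
    · exact ⟨h1, h2, h3⟩
  rcases BetaSeries.sub_mem_Theta_or hne with h | h
  · exact BetaSeries.algebraicIndependent_xi_of_sub_mem h₁ h₂ h h1 hint hconj
  · have := BetaSeries.algebraicIndependent_xi_of_sub_mem h₂ h₁ h h1 hint hconj
    refine (algebraicIndependent_equiv' (Equiv.swap (0 : Fin 2) 1) ?_).mpr this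
    funext i
    fin_cases i <;> rfl
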